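/- Let $\mathcal E$ be a Euclidean affine space of finite dimension with translation vector space $\mathcal V$. A *Bieberbach group* in $\mathcal E$ is a torsion-free discrete subgroup $\Pi$ of the isometry group $\mathrm{Iso}\,\mathcal E$ for which there is a compact subset of $\mathcal E$ meeting every $\Pi$-orbit. Its *lattice subgroup* $L=\Pi\cap\mathcal V$ is the set of all translations lying in $\Pi$, treated as vectors of $\mathcal V$; its *holonomy group* $H$ is the group of linear parts of the elements of $\Pi$. An *$L$-subspace* of $\mathcal V$ is a vector subspace $\mathcal V'$ spanned by $L\cap\mathcal V'$. The quotients $\mathcal M=\mathcal E/\Pi$ and $\mathcal T=\mathcal E/L$ carry the projected flat Riemannian metrics, and $\mathrm{pr}:\mathcal E\to\mathcal M$, $\mathrm{pr}_{\mathcal T}:\mathcal E\to\mathcal T$ denote the projections. The leaves of an integrable distribution are its maximal connected integral manifolds, endowed with their own manifold topologies. **Theorem.** Let $\Pi$ be a Bieberbach group in $\mathcal E$, and let $\mathcal V'$ be a nonzero proper $H$-invariant $L$-subspace of $\mathcal V$. (i) The affine subspaces of $\mathcal E$ parallel to $\mathcal V'$ and of dimension $\dim\mathcal V'$ are the leaves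 of a foliation $F_{\mathcal E}$ on $\mathcal E$, which is projectable under $\mathrm{pr}$ and $\mathrm{pr}_{\mathcal T}$ onto foliations $F_{\mathcal M}$ of $\mathcal M$ and $F_{\mathcal T}$ of the torus $\mathcal T$. Both $F_{\mathcal M}$ and $F_{\mathcal T}$ have compact totally geodesic leaves, tangent to a parallel distribution. (ii) The leaves of $F_{\mathcal M}$ are precisely the images $\mathcal M'=\mathrm{pr}(\mathcal E')$ of the leaves $\mathcal E'$ of $F_{\mathcal E}$, and each restriction $\mathrm{pr}:\mathcal E'\to\mathcal M'$ is a (smooth) covering projection. The same holds for $\mathcal T$ and $\mathrm{pr}_{\mathcal T}$ in place of $\mathcal M$ and $\mathrm{pr}$. Every such $\mathcal M'=\mathrm{pr}(\mathcal E')$, with its submanifold metric, is a compact flat Riemannian manifold, and there is a Bieberbach group $\Pi'$ in the Euclidean affine space $\mathcal E'$ such that $\mathrm{pr}$ induces an isometry $\mathcal E'/\Pi'\to\mathcal M'$. Moreover, if $\Sigma'$ is the group of all $\gamma\in\Pi$ with $\gamma(\mathcal E')=\mathcal E'$, and $L'$, $H'$ are the lattice subgroup and the holonomy group of $\Pi'$,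 then (a) $\Pi'$ consists of the restrictions to $\mathcal E'$ of all the elements of $\Sigma'$; (b) $H'$ consists of the restrictions to $\mathcal V'$ of the linear parts of the elements of $\Sigma'$; (c) $L'=\Pi'\cap\mathcal V'$, and $L\cap\mathcal V'\subseteq L'$. -/

import Mathlib

open Set Filter Topology Manifold
open scoped ContDiff

noncomputable section

section Groups

variable {V E : Type*} [NormedAddCommGroup V] [InnerProductSpace ℝ V]
  [MetricSpace E] [NormedAddTorsor V E]

/-- Isometries of a Euclidean affine space act on it by evaluation. -/
instance affineIsometryMulAction : MulAction (E ≃ᵃⁱ[ℝ] E) E where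
  smul γ x := γ x
  one_smul _ := rfl
  mul_smul _ _ _ := rfl

/-- The topology of pointwise convergence on the isometry group (which, for isometries, is the same
as the topology of uniform convergence on compact sets). -/
instance affineIsometryTopology : TopologicalSpace (E ≃ᵃⁱ[ℝ] E) :=
  TopologicalSpace.induced (fun γ (x : E) ↦ γ x) inferInstance

/-- Torsion-free discrete groups of isometries of a Euclidean affine space. -/
class IsDiscreteTorsionFree (Γ : Subgroup (E ≃ᵃⁱ[ℝ] E)) : Prop where
  discrete : DiscreteTopology Γ
  torsionFree : ∀ γ ∈ Γ, IsOfFinOrder γ → γ = 1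

/-- Bieberbach groups: torsion-free discrete groups of isometries having a compact fundamental domain,
that is, a compact set which meets every orbit. -/
class IsBieberbach (Γ : Subgroup (E ≃ᵃⁱ[ℝ] E)) : Prop extends IsDiscreteTorsionFree Γ where
  exists_compact : ∃ K : Set E, IsCompact K ∧ ∀ x : E, ∃ γ ∈ Γ, γ x ∈ K

/-- The group of all translations of `E` that lie in `Γ`. -/
def translationSubgroup (Γ : Subgroup (E ≃ᵃⁱ[ℝ] E)) : Subgroup (E ≃ᵃⁱ[ℝ] E) where
  carrier := {γ | γ ∈ Γ ∧ ∃ v : V, ∀ x : E, γ x = v +ᵥ x}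
  one_mem' := ⟨Γ.one_mem, 0, fun x ↦ (zero_vadd V x).symm⟩
  mul_mem' := by
    rintro a b ⟨ha, v, hv⟩ ⟨hb, w, hw⟩
    refine ⟨Γ.mul_mem ha hb, v + w, fun x ↦ ?_⟩
    change a (b x) = _
    rw [hw, hv, vadd_vadd]
  inv_mem' := by
    rintro a ⟨ha, v, hv⟩
    refine ⟨Γ.inv_mem ha, -v, fun x ↦ ?_⟩
    change a.symm x = _
    rw [AffineIsometryEquiv.symm_apply_eq, hv, vadd_vadd, add_neg_cancel, zero_vadd]

/-- The lattice subgroup of `Γ`: the same translations, viewed as vectors. -/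
def latticeSubgroup (Γ : Subgroup (E ≃ᵃⁱ[ℝ] E)) : AddSubgroup V where
  carrier := {v | ∃ γ ∈ Γ, ∀ x : E, γ x = v +ᵥ x}
  zero_mem' := ⟨1, Γ.one_mem, fun x ↦ (zero_vadd V x).symm⟩
  add_mem' := by
    rintro v w ⟨a, ha, hv⟩ ⟨b, hb, hw⟩
    refine ⟨a * b, Γ.mul_mem ha hb, fun x ↦ ?_⟩
    change a (b x) = _
    rw [hw, hv, vadd_vadd]
  neg_mem' := by
    rintro v ⟨a, ha, hv⟩
    refine ⟨a⁻¹, Γ.inv_mem ha, fun x ↦ ?_⟩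
    change a.symm x = _
    rw [AffineIsometryEquiv.symm_apply_eq, hv, vadd_vadd, add_neg_cancel, zero_vadd]

/-- The holonomy group of `Γ`: the linear parts of its elements. -/
def holonomyGroup (Γ : Subgroup (E ≃ᵃⁱ[ℝ] E)) : Subgroup (V ≃ₗᵢ[ℝ] V) :=
  Γ.map
    { toFun := fun γ ↦ γ.linearIsometryEquiv
      map_one' := rfl
      map_mul' := fun _ _ ↦ rfl }

instance (Γ : Subgroup (E ≃ᵃⁱ[ℝ] E)) [h : IsDiscreteTorsionFree Γ] :
    IsDiscreteTorsionFree (translationSubgroup Γ) where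
  discrete := by
    have := h.discrete
    exact DiscreteTopology.of_subset (s := (Γ : Set (E ≃ᵃⁱ[ℝ] E))) this fun γ hγ ↦ hγ.1
  torsionFree γ hγ := h.torsionFree γ hγ.1

/-- Discreteness, spelled out at the identity. -/
theorem exists_forall_dist_lt (Γ : Subgroup (E ≃ᵃⁱ[ℝ] E)) [h : IsDiscreteTorsionFree Γ] :
    ∃ (F : Finset E) (ε : ℝ), 0 < ε ∧
      ∀ γ ∈ Γ, (∀ p ∈ F, dist (γ p) p < ε) → γ = 1 := by
  have h0 := h.discrete
  have h1 : ({1} : Set Γ) ∈ 𝓝 (1 : Γ) := by simp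
  rw [nhds_subtype, mem_comap] at h1
  obtain ⟨t, ht, hts⟩ := h1
  rw [nhds_induced, mem_comap] at ht
  obtain ⟨u, hu, hut⟩ := ht
  rw [nhds_pi, Filter.mem_pi'] at hu
  obtain ⟨F, w, hw, hwu⟩ := hu
  have : ∀ p : E, ∃ ε > 0, Metric.ball p ε ⊆ w p := fun p ↦ Metric.mem_nhds_iff.mp (hw p)
  choose ε hε hb using this
  obtain ⟨δ, hδ, hδF⟩ : ∃ δ : ℝ, 0 < δ ∧ ∀ p ∈ F, δ ≤ ε p := by
    rcases F.eq_empty_or_nonempty with rfl | hF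
    · exact ⟨1, one_pos, by simp⟩
    · exact ⟨F.inf' hF ε, by simpa using fun p _ ↦ hε p, fun p hp ↦ Finset.inf'_le _ hp⟩
  refine ⟨F, δ, hδ, fun γ hγ hd ↦ ?_⟩
  have : (⟨γ, hγ⟩ : Γ) ∈ ({1} : Set Γ) := hts (hut (hwu fun p hp ↦
    hb p (lt_of_lt_of_le (hd p hp) (hδF p hp))))
  exact congrArg Subtype.val (mem_singleton_iff.mp this)

variable [FiniteDimensional ℝ V]

instance affineProperSpace : ProperSpace E :=
  ⟨fun x r ↦ by
    have h := (isCompact_closedBall (0 : V) r).image (IsometryEquiv.vaddConst x).continuous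
    have h0 : IsometryEquiv.vaddConst x (0 : V) = x := zero_vadd V x
    rwa [IsometryEquiv.image_closedBall, h0] at h⟩

instance (Γ : Subgroup (E ≃ᵃⁱ[ℝ] E)) [h : IsDiscreteTorsionFree Γ] :
    ProperlyDiscontinuousSMul Γ E where
  finite_disjoint_inter_image {K L} hK hL := by
    obtain ⟨F, ε, hε, hF⟩ := exists_forall_dist_lt Γ
    rcases K.eq_empty_or_nonempty with rfl | ⟨x₀, hx₀⟩
    · simp
    obtain ⟨R, hR⟩ := (hK.union hL).isBounded.subset_closedBall x₀
    -- all the displacement functions that matter lie in a compact product of balls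
    have hP : IsCompact (Set.univ.pi fun x : E ↦ Metric.closedBall x₀ (dist x x₀ + (R + R))) :=
      isCompact_univ_pi fun x ↦ isCompact_closedBall _ _
    let U : (E → E) → Set (E → E) := fun f ↦ (F : Set E).pi fun p ↦ Metric.ball (f p) (ε / 2)
    obtain ⟨T, -, hTU⟩ := hP.elim_nhds_subcover U fun f _ ↦
      set_pi_mem_nhds F.finite_toSet fun p _ ↦ Metric.ball_mem_nhds _ (half_pos hε)
    have hmem : ∀ γ ∈ {γ : Γ | ((γ • ·) '' K ∩ L).Nonempty},
        ∃ f ∈ T, (fun x : E ↦ (γ : E ≃ᵃⁱ[ℝ] E) x) ∈ U f := by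
      rintro γ ⟨_, ⟨y, hy, rfl⟩, hyL⟩
      have : (fun x : E ↦ (γ : E ≃ᵃⁱ[ℝ] E) x) ∈ ⋃ f ∈ T, U f := hTU fun x _ ↦ by
        have h1 : dist y x₀ ≤ R := hR (Or.inl hy)
        have h2 : dist ((γ : E ≃ᵃⁱ[ℝ] E) y) x₀ ≤ R := hR (Or.inr hyL)
        have h3 := (γ : E ≃ᵃⁱ[ℝ] E).dist_map x y
        have h4 := dist_triangle ((γ : E ≃ᵃⁱ[ℝ] E) x) ((γ : E ≃ᵃⁱ[ℝ] E) y) x₀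
        have h5 := dist_triangle_right x y x₀
        simp only [Metric.mem_closedBall]
        linarith
      simpa using this
    choose! c hcT hcU using hmem
    refine Set.Finite.of_injOn (f := c) (t := (T : Set (E → E))) (fun γ hγ ↦ hcT γ hγ) ?_
      T.finite_toSet
    intro a ha b hb hab
    have h1 := hcU a ha
    have h2 := hcU b hb
    rw [hab] at h1
    have key := hF ((b : E ≃ᵃⁱ[ℝ] E)⁻¹ * a) (Γ.mul_mem (Γ.inv_mem b.2) a.2) fun p hp ↦ by
      have h3 : dist ((a : E ≃ᵃⁱ[ℝ] E) p) (c b p) < ε / 2 := h1 p hp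
      have h4 : dist ((b : E ≃ᵃⁱ[ℝ] E) p) (c b p) < ε / 2 := h2 p hp
      have h5 := dist_triangle_right ((a : E ≃ᵃⁱ[ℝ] E) p) ((b : E ≃ᵃⁱ[ℝ] E) p) (c b p)
      have h6 := (b : E ≃ᵃⁱ[ℝ] E).symm.dist_map ((a : E ≃ᵃⁱ[ℝ] E) p) ((b : E ≃ᵃⁱ[ℝ] E) p)
      rw [AffineIsometryEquiv.symm_apply_apply] at h6
      change dist ((b : E ≃ᵃⁱ[ℝ] E).symm ((a : E ≃ᵃⁱ[ℝ] E) p)) p < ε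
      linarith
    exact Subtype.ext (inv_mul_eq_one.mp key).symm

instance (Γ : Subgroup (E ≃ᵃⁱ[ℝ] E)) [h : IsDiscreteTorsionFree Γ] :
    IsCancelSMul Γ E where
  right_cancel' := by
    intro a b x hab
    have hfin : Finite (MulAction.stabilizer Γ x) := by
      refine Set.Finite.subset (ProperlyDiscontinuousSMul.finite_disjoint_inter_image (Γ := Γ)
        (isCompact_singleton (x := x)) (isCompact_singleton (x := x))) fun γ hγ ↦ ?_
      exact ⟨x, ⟨x, rfl, hγ⟩, rfl⟩
    have hmem : b⁻¹ * a ∈ MulAction.stabilizer Γ x := by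
      rw [MulAction.mem_stabilizer_iff, mul_smul, hab, inv_smul_smul]
    have hord : IsOfFinOrder ((b⁻¹ * a : Γ) : E ≃ᵃⁱ[ℝ] E) := by
      have h1 := isOfFinOrder_of_finite (⟨b⁻¹ * a, hmem⟩ : MulAction.stabilizer Γ x)
      have h2 := (MulAction.stabilizer Γ x).subtype.isOfFinOrder h1
      exact Γ.subtype.isOfFinOrder h2
    have h3 := h.torsionFree _ (b⁻¹ * a).2 hord
    exact (inv_mul_eq_one.mp (Subtype.ext h3)).symm

instance (Γ : Subgroup (E ≃ᵃⁱ[ℝ] E)) : ContinuousConstSMul Γ E where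
  continuous_const_smul γ := (γ : E ≃ᵃⁱ[ℝ] E).continuous

end Groups

section Quotient

/-- The global chart `x ↦ x - o` of a Euclidean affine space. -/
def affineChart (V E : Type*) [NormedAddCommGroup V] [InnerProductSpace ℝ V]
    [MetricSpace E] [NormedAddTorsor V E] : E ≃ₜ V :=
  (IsometryEquiv.vaddConst (Classical.arbitrary E) : V ≃ᵢ E).symm.toHomeomorph

variable {V E : Type*} [NormedAddCommGroup V] [InnerProductSpace ℝ V]
  [MetricSpace E] [NormedAddTorsor V E]

/-- A Euclidean affine space is a manifold with one global chart. -/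
instance (priority := 10) affineChartedSpace : ChartedSpace V E :=
  (affineChart V E).toOpenPartialHomeomorph.singletonChartedSpace rfl

instance : IsManifold 𝓘(ℝ, V) ∞ E :=
  (affineChart V E).toOpenPartialHomeomorph.isManifold_singleton rfl

/-- The quotient `E / Γ`. Mathlib gives it the quotient topology and, when `Γ` acts freely and properly
discontinuously, the atlas formed by local inverses of the projection followed by the chart of `E`. -/
abbrev FlatQuotient (Γ : Subgroup (E ≃ᵃⁱ[ℝ] E)) : Type _ := MulAction.orbitRel.Quotient Γ E

/-- The projection `E → E / Γ`. -/
def quotientProj (Γ : Subgroup (E ≃ᵃⁱ[ℝ] E)) : E → FlatQuotient Γ := Quotient.mk _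

/-- In the global chart, isometries are affine. -/
theorem affineChart_conj (γ : E ≃ᵃⁱ[ℝ] E) (y : V) :
    affineChart V E (γ ((affineChart V E).symm y)) =
      γ.linearIsometryEquiv y + affineChart V E (γ ((affineChart V E).symm 0)) := by
  have h : (affineChart V E).symm y = y +ᵥ (affineChart V E).symm 0 := by
    change y +ᵥ (Classical.arbitrary E) = y +ᵥ ((0 : V) +ᵥ Classical.arbitrary E)
    rw [zero_vadd]
  rw [h, γ.map_vadd]
  exact vadd_vsub_assoc _ _ _

variable [FiniteDimensional ℝ V]

theorem atlas_symm_apply (Γ : Subgroup (E ≃ᵃⁱ[ℝ] E)) [IsDiscreteTorsionFree Γ]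
    {e : OpenPartialHomeomorph (FlatQuotient Γ) V} (he : e ∈ atlas V (FlatQuotient Γ)) (y : V) :
    e.symm y = quotientProj Γ ((affineChart V E).symm y) := by
  obtain ⟨q, rfl⟩ := he
  rw [OpenPartialHomeomorph.coe_trans_symm, Function.comp_apply,
    IsLocalHomeomorph.localInverseAt_symm]
  rfl

/-- The transition mappings of `E / Γ` are locally affine isometries. -/
theorem transition_eventuallyEq (Γ : Subgroup (E ≃ᵃⁱ[ℝ] E)) [IsDiscreteTorsionFree Γ]
    {e e' : OpenPartialHomeomorph (FlatQuotient Γ) V} (he : e ∈ atlas V (FlatQuotient Γ))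
    (he' : e' ∈ atlas V (FlatQuotient Γ)) {y : V} (hy : y ∈ (e.symm ≫ₕ e').source) :
    ∃ (A : V ≃ₗᵢ[ℝ] V) (b : V), (e.symm ≫ₕ e') =ᶠ[𝓝 y] fun z ↦ A z + b := by
  have hye : y ∈ e.target := hy.1
  have hye' : e.symm y ∈ e'.source := hy.2
  have h1 : e'.symm (e' (e.symm y)) = e.symm y := e'.left_inv hye'
  rw [atlas_symm_apply Γ he', atlas_symm_apply Γ he] at h1
  obtain ⟨γ, hγ⟩ := Quotient.exact h1
  set φ := affineChart V E with hφ
  have hγ' : (γ : E ≃ᵃⁱ[ℝ] E) (φ.symm y) = φ.symm (e' (e.symm y)) := by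
    rw [atlas_symm_apply Γ he]; exact hγ
  refine ⟨(γ : E ≃ᵃⁱ[ℝ] E).linearIsometryEquiv, φ ((γ : E ≃ᵃⁱ[ℝ] E) (φ.symm 0)), ?_⟩
  have hc : Continuous fun z ↦ φ ((γ : E ≃ᵃⁱ[ℝ] E) (φ.symm z)) :=
    φ.continuous.comp ((γ : E ≃ᵃⁱ[ℝ] E).continuous.comp φ.symm.continuous)
  have hmem : φ ((γ : E ≃ᵃⁱ[ℝ] E) (φ.symm y)) ∈ e'.target := by
    rw [hγ', φ.apply_symm_apply]; exact e'.map_source hye'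
  filter_upwards [hc.continuousAt.preimage_mem_nhds (e'.open_target.mem_nhds hmem)] with z hz
  rw [← affineChart_conj, OpenPartialHomeomorph.coe_trans, Function.comp_apply]
  have h2 : e.symm z = e'.symm (φ ((γ : E ≃ᵃⁱ[ℝ] E) (φ.symm z))) := by
    rw [atlas_symm_apply Γ he, atlas_symm_apply Γ he', ← hφ, φ.symm_apply_apply]
    exact Quotient.sound' (s₁ := MulAction.orbitRel Γ E) ⟨γ⁻¹, inv_smul_smul γ _⟩
  rw [h2, e'.right_inv hz]

instance (Γ : Subgroup (E ≃ᵃⁱ[ℝ] E)) [IsDiscreteTorsionFree Γ] :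
    IsManifold 𝓘(ℝ, V) ∞ (FlatQuotient Γ) := by
  refine isManifold_of_contDiffOn _ _ _ fun e e' he he' y hy ↦ ?_
  obtain ⟨A, b, hA⟩ := transition_eventuallyEq Γ he he' (y := y) (by simpa using hy)
  refine ContDiffAt.contDiffWithinAt (ContDiffAt.congr_of_eventuallyEq ?_ hA)
  exact (A.contDiff.add contDiff_const).contDiffAt

theorem tangentCoordChange_isometry (Γ : Subgroup (E ≃ᵃⁱ[ℝ] E)) [IsDiscreteTorsionFree Γ]
    {m₁ m₂ m : FlatQuotient Γ} (h₁ : m ∈ (chartAt V m₁).source) (h₂ : m ∈ (chartAt V m₂).source) :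
    ∃ (A : V ≃ₗᵢ[ℝ] V), ∀ v : V, tangentCoordChange 𝓘(ℝ, V) m₁ m₂ m v = A v := by
  obtain ⟨A, b, hA⟩ := transition_eventuallyEq Γ (chart_mem_atlas V m₁) (chart_mem_atlas V m₂)
    (y := chartAt V m₁ m) (by simp [h₁, h₂])
  refine ⟨A, fun v ↦ ?_⟩
  rw [tangentCoordChange_def]
  have h1 : HasFDerivAt (extChartAt 𝓘(ℝ, V) m₂ ∘ (extChartAt 𝓘(ℝ, V) m₁).symm)
      (A : V →L[ℝ] V) (extChartAt 𝓘(ℝ, V) m₁ m) := by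
    refine HasFDerivAt.congr_of_eventuallyEq (f := fun z ↦ A z + b) ?_ ?_
    · exact (A : V →L[ℝ] V).hasFDerivAt.add_const b
    · simpa using hA
  simp only [modelWithCornersSelf_coe, range_id, fderivWithin_univ]
  rw [h1.fderiv]
  rfl

/-- The inner product of `V`, in the tangent space of `E / Γ` at `m`, identified with `V` via the preferred
chart at `m`. -/
def flatInner (Γ : Subgroup (E ≃ᵃⁱ[ℝ] E)) [IsDiscreteTorsionFree Γ] (m : FlatQuotient Γ) :
    TangentSpace 𝓘(ℝ, V) m →L[ℝ] TangentSpace 𝓘(ℝ, V) m →L[ℝ] ℝ :=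
  (innerSL ℝ : V →L[ℝ] V →L[ℝ] ℝ)

/-- The projected metric on `E / Γ`, for which the projection from `E` is a local isometry
(`quotientMetric_mfderiv`). -/
def quotientMetric (Γ : Subgroup (E ≃ᵃⁱ[ℝ] E)) [IsDiscreteTorsionFree Γ] :
    Bundle.ContMDiffRiemannianMetric 𝓘(ℝ, V) ∞ V
      (fun m : FlatQuotient Γ ↦ TangentSpace 𝓘(ℝ, V) m) where
  inner m := flatInner Γ m
  symm m v w := (riemannianMetricVectorSpace V).symm 0 v w
  pos m v hv := (riemannianMetricVectorSpace V).pos 0 v hv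
  isVonNBounded m := (riemannianMetricVectorSpace V).isVonNBounded 0
  contMDiff := by
    intro m
    rw [Bundle.contMDiffAt_section]
    let c : V →L[ℝ] V →L[ℝ] ℝ := innerSL ℝ (E := V)
    refine (contMDiffAt_const (c := c)).congr_of_eventuallyEq ?_
    filter_upwards [(chartAt V m).open_source.mem_nhds (mem_chart_source V m)] with m' hm'
    obtain ⟨A, hA⟩ := tangentCoordChange_isometry Γ hm' (mem_chart_source V m')
    have hs : ∀ u : V, ((trivializationAt V (TangentSpace 𝓘(ℝ, V)) m).symmL ℝ m' u : V) = A u := by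
      intro u
      rw [TangentBundle.symmL_trivializationAt_eq_core hm']
      exact hA u
    ext v w
    simp only [hom_trivializationAt_apply, ContinuousLinearMap.inCoordinates]
    rw [ContinuousLinearMap.comp_apply, Bundle.Trivialization.continuousLinearMapAt_apply,
      Bundle.Trivialization.coe_linearMapAt_of_mem]
    · simp only [hom_trivializationAt_apply, ContinuousLinearMap.inCoordinates,
        Bundle.Trivial.fiberBundle_trivializationAt', Bundle.Trivial.continuousLinearMapAt_trivialization]
      change @inner ℝ V _ ((trivializationAt V (TangentSpace 𝓘(ℝ, V)) m).symmL ℝ m' v : V)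
        ((trivializationAt V (TangentSpace 𝓘(ℝ, V)) m).symmL ℝ m' w : V) = inner ℝ v w
      rw [hs, hs, A.inner_map_map]
    · simpa using hm'

theorem quotientProj_hasMFDerivAt (Γ : Subgroup (E ≃ᵃⁱ[ℝ] E)) [IsDiscreteTorsionFree Γ] (x : E) :
    ∃ A : V ≃ₗᵢ[ℝ] V, HasMFDerivAt 𝓘(ℝ, V) 𝓘(ℝ, V) (quotientProj Γ) x (A : V →L[ℝ] V) := by
  set φ := affineChart V E with hφ
  set e := chartAt V (quotientProj Γ x) with he
  have hea : e ∈ atlas V (FlatQuotient Γ) := chart_mem_atlas V _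
  have hxe : quotientProj Γ x ∈ e.source := mem_chart_source V _
  have h1 : e.symm (e (quotientProj Γ x)) = quotientProj Γ x := e.left_inv hxe
  rw [atlas_symm_apply Γ hea] at h1
  obtain ⟨γ, hγ⟩ := Quotient.exact h1
  have hγ' : (γ : E ≃ᵃⁱ[ℝ] E) x = φ.symm (e (quotientProj Γ x)) := hγ
  refine ⟨(γ : E ≃ᵃⁱ[ℝ] E).linearIsometryEquiv, continuous_quotient_mk'.continuousAt, ?_⟩
  have hc : Continuous fun z ↦ φ ((γ : E ≃ᵃⁱ[ℝ] E) (φ.symm z)) :=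
    φ.continuous.comp ((γ : E ≃ᵃⁱ[ℝ] E).continuous.comp φ.symm.continuous)
  have hmem : φ ((γ : E ≃ᵃⁱ[ℝ] E) (φ.symm (φ x))) ∈ e.target := by
    rw [φ.symm_apply_apply, hγ', φ.apply_symm_apply]; exact e.map_source hxe
  refine HasFDerivAt.hasFDerivWithinAt (HasFDerivAt.congr_of_eventuallyEq
    (f := fun z ↦ (γ : E ≃ᵃⁱ[ℝ] E).linearIsometryEquiv z + φ ((γ : E ≃ᵃⁱ[ℝ] E) (φ.symm 0)))
    ((((γ : E ≃ᵃⁱ[ℝ] E).linearIsometryEquiv : V →L[ℝ] V)).hasFDerivAt.add_const _) ?_)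
  filter_upwards [hc.continuousAt.preimage_mem_nhds (e.open_target.mem_nhds hmem)] with z hz
  rw [← affineChart_conj]
  change e (quotientProj Γ (φ.symm z)) = φ ((γ : E ≃ᵃⁱ[ℝ] E) (φ.symm z))
  have h2 : quotientProj Γ (φ.symm z) = e.symm (φ ((γ : E ≃ᵃⁱ[ℝ] E) (φ.symm z))) := by
    rw [atlas_symm_apply Γ hea, ← hφ, φ.symm_apply_apply]
    exact Quotient.sound' (s₁ := MulAction.orbitRel Γ E) ⟨γ⁻¹, inv_smul_smul γ _⟩
  rw [h2, e.right_inv hz]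

/-- The projection `E → E / Γ` is isometric on tangent spaces. -/
theorem quotientMetric_mfderiv (Γ : Subgroup (E ≃ᵃⁱ[ℝ] E)) [IsDiscreteTorsionFree Γ] (x : E)
    (u v : V) :
    (quotientMetric Γ).inner (quotientProj Γ x)
      (mfderiv 𝓘(ℝ, V) 𝓘(ℝ, V) (quotientProj Γ) x u)
      (mfderiv 𝓘(ℝ, V) 𝓘(ℝ, V) (quotientProj Γ) x v) = inner ℝ u v := by
  obtain ⟨A, hA⟩ := quotientProj_hasMFDerivAt Γ x
  rw [hA.mfderiv]
  exact A.inner_map_map u v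

end Quotient

section Geometry

universe u v

variable {F : Type v} [NormedAddCommGroup F] [NormedSpace ℝ F]
  {N : Type u} [TopologicalSpace N] [ChartedSpace F N]

/-- A (smooth) distribution: a vector subbundle of the tangent bundle, that is, a choice of a
subspace of each tangent space which is locally spanned by a smooth frame. -/
structure TangentDistribution (F : Type v) [NormedAddCommGroup F] [NormedSpace ℝ F]
    (N : Type u) [TopologicalSpace N] [ChartedSpace F N] [IsManifold 𝓘(ℝ, F) ∞ N] where
  fiber (x : N) : Submodule ℝ (TangentSpace 𝓘(ℝ, F) x)
  exists_frame (x₀ : N) : ∃ (k : ℕ) (X : Fin k → ∀ x : N, TangentSpace 𝓘(ℝ, F) x) (U : Set N),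
    IsOpen U ∧ x₀ ∈ U ∧
    (∀ i, ContMDiffOn 𝓘(ℝ, F) 𝓘(ℝ, F).tangent ∞
      (fun x ↦ (⟨x, X i x⟩ : TangentBundle 𝓘(ℝ, F) N)) U) ∧
    ∀ x ∈ U, LinearIndependent ℝ (fun i ↦ X i x) ∧
      Submodule.span ℝ (range fun i ↦ X i x) = fiber x

/-- A submanifold of `N`, with its own (possibly finer) topology: a manifold together with an
injective immersion into `N`. -/
structure ImmersedSubmanifold (F : Type v) [NormedAddCommGroup F] [NormedSpace ℝ F]
    (N : Type u) [TopologicalSpace N] [ChartedSpace F N] where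
  Pt : Type u
  [topPt : TopologicalSpace Pt]
  [t2Pt : T2Space Pt]
  [secondCountablePt : SecondCountableTopology Pt]
  dim : ℕ
  [chartedPt : ChartedSpace (EuclideanSpace ℝ (Fin dim)) Pt]
  [manifoldPt : IsManifold 𝓘(ℝ, EuclideanSpace ℝ (Fin dim)) ∞ Pt]
  incl : Pt → N
  incl_injective : Function.Injective incl
  contMDiff_incl : ContMDiff 𝓘(ℝ, EuclideanSpace ℝ (Fin dim)) 𝓘(ℝ, F) ∞ incl
  mfderiv_incl_injective (p : Pt) : Function.Injective
    (mfderiv 𝓘(ℝ, EuclideanSpace ℝ (Fin dim)) 𝓘(ℝ, F) incl p)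

attribute [instance] ImmersedSubmanifold.topPt ImmersedSubmanifold.t2Pt
  ImmersedSubmanifold.secondCountablePt ImmersedSubmanifold.chartedPt
  ImmersedSubmanifold.manifoldPt

namespace ImmersedSubmanifold

/-- The model with corners (without boundary) of a submanifold. -/
abbrev model (S : ImmersedSubmanifold F N) :
    ModelWithCorners ℝ (EuclideanSpace ℝ (Fin S.dim)) (EuclideanSpace ℝ (Fin S.dim)) :=
  𝓘(ℝ, EuclideanSpace ℝ (Fin S.dim))

/-- The differential of the inclusion, which identifies the tangent space of the submanifold at `p`
with a subspace of the tangent space of the ambient manifold. -/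
def dIncl (S : ImmersedSubmanifold F N) (p : S.Pt) :
    TangentSpace S.model p →L[ℝ] TangentSpace 𝓘(ℝ, F) (S.incl p) :=
  mfderiv S.model 𝓘(ℝ, F) S.incl p

/-- The tangent space of a submanifold as a subspace of the ambient tangent space. -/
def tangent (S : ImmersedSubmanifold F N) (p : S.Pt) :
    Submodule ℝ (TangentSpace 𝓘(ℝ, F) (S.incl p)) :=
  LinearMap.range (S.dIncl p).toLinearMap

end ImmersedSubmanifold

variable [IsManifold 𝓘(ℝ, F) ∞ N]

namespace TangentDistribution

/-- Integral manifolds: submanifolds with tangent spaces equal to the fibers of the distribution. -/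
def IsIntegralManifold (D : TangentDistribution F N) (S : ImmersedSubmanifold F N) : Prop :=
  ∀ p : S.Pt, S.tangent p = D.fiber (S.incl p)

/-- The leaves of a distribution: its maximal connected integral manifolds. -/
def IsLeaf (D : TangentDistribution F N) (S : ImmersedSubmanifold F N) : Prop :=
  ConnectedSpace S.Pt ∧ D.IsIntegralManifold S ∧
    ∀ S' : ImmersedSubmanifold F N, ConnectedSpace S'.Pt → D.IsIntegralManifold S' →
      range S.incl ⊆ range S'.incl → range S'.incl = range S.incl

/-- The underlying point sets of the leaves. -/
def leafSets (D : TangentDistribution F N) : Set (Set N) :=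
  {A | ∃ S : ImmersedSubmanifold F N, D.IsLeaf S ∧ range S.incl = A}

/-- A distribution is integrable, and so its leaves form a foliation, if through every point
there passes an integral manifold. -/
def IsIntegrable (D : TangentDistribution F N) : Prop :=
  ∀ x : N, ∃ S : ImmersedSubmanifold F N, D.IsIntegralManifold S ∧ x ∈ range S.incl

/-- Projectability of a distribution `D` under a mapping `ψ`, onto a distribution `D'`. -/
def ProjectsOnto {F' : Type*} [NormedAddCommGroup F'] [NormedSpace ℝ F']
    {N' : Type*} [TopologicalSpace N'] [ChartedSpace F' N'] [IsManifold 𝓘(ℝ, F') ∞ N']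
    (D : TangentDistribution F N) (ψ : N → N') (D' : TangentDistribution F' N') : Prop :=
  ∀ x : N, (D.fiber x).map (mfderiv 𝓘(ℝ, F) 𝓘(ℝ, F') ψ x).toLinearMap = D'.fiber (ψ x)

end TangentDistribution

/-- Smooth Riemannian metrics on a manifold. -/
abbrev SmoothMetric (F : Type v) [NormedAddCommGroup F] [NormedSpace ℝ F]
    (N : Type u) [TopologicalSpace N] [ChartedSpace F N] [IsManifold 𝓘(ℝ, F) ∞ N] : Type _ :=
  Bundle.ContMDiffRiemannianMetric 𝓘(ℝ, F) ∞ F (fun x : N ↦ TangentSpace 𝓘(ℝ, F) x)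

/-- The components of the metric in the chart at `x₀`: the inner product, at the point with the
coordinates `p`, of the tangent vectors with the components `a` and `b`. -/
def metricComponents (g : SmoothMetric F N) (x₀ : N) (p a b : F) : ℝ :=
  g.inner ((extChartAt 𝓘(ℝ, F) x₀).symm p)
    ((trivializationAt F (TangentSpace 𝓘(ℝ, F)) x₀).symmL ℝ ((extChartAt 𝓘(ℝ, F) x₀).symm p) a)
    ((trivializationAt F (TangentSpace 𝓘(ℝ, F)) x₀).symmL ℝ ((extChartAt 𝓘(ℝ, F) x₀).symm p) b)

/-- The Christoffel symbols (of the first kind) of the Levi-Civita connection at `x₀`, in the chart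
at `x₀`: half of `∂ₐ g(b, z) + ∂_b g(a, z) - ∂_z g(a, b)`. -/
def christoffel (g : SmoothMetric F N) (x₀ : N) (a b z : F) : ℝ :=
  (fderiv ℝ (fun p ↦ metricComponents g x₀ p b z) (extChartAt 𝓘(ℝ, F) x₀ x₀) a
    + fderiv ℝ (fun p ↦ metricComponents g x₀ p a z) (extChartAt 𝓘(ℝ, F) x₀ x₀) b
    - fderiv ℝ (fun p ↦ metricComponents g x₀ p a b) (extChartAt 𝓘(ℝ, F) x₀ x₀) z) / 2

/-- Smoothness of a vector field `Y` along a curve `c` (and of `c` itself). -/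
def IsSmoothAlong (c : ℝ → N) (Y : ∀ t : ℝ, TangentSpace 𝓘(ℝ, F) (c t)) : Prop :=
  ContMDiff 𝓘(ℝ, ℝ) 𝓘(ℝ, F).tangent ∞ (fun t ↦ (⟨c t, Y t⟩ : TangentBundle 𝓘(ℝ, F) N))

/-- `W` is the covariant derivative at `t` of the vector field `Y` along the curve `c`, relative to
the Levi-Civita connection of `g`. In the chart at `c t` (in which the tangent space at `c t` is the
model space `F`) this is the formula `W = dY/dt + Γ(dc/dt, Y)`, with the index lowered by `g`. As
`g` is nondegenerate, there is exactly one such `W`. -/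
def IsCovariantDerivAt (g : SmoothMetric F N) (c : ℝ → N)
    (Y : ∀ t : ℝ, TangentSpace 𝓘(ℝ, F) (c t)) (t : ℝ) (W : TangentSpace 𝓘(ℝ, F) (c t)) : Prop :=
  ∀ z : F, g.inner (c t) W z =
    g.inner (c t)
      (deriv (fun s : ℝ ↦ (trivializationAt F (TangentSpace 𝓘(ℝ, F)) (c t) ⟨c s, Y s⟩).2) t) z
    + christoffel g (c t) (deriv (fun s : ℝ ↦ extChartAt 𝓘(ℝ, F) (c t) (c s)) t) (Y t) z

/-- A distribution is parallel if covariant derivatives of its sections (here: along curves) are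
again sections of it. -/
def TangentDistribution.IsParallel (D : TangentDistribution F N) (g : SmoothMetric F N) : Prop :=
  ∀ (c : ℝ → N) (Y : ∀ t : ℝ, TangentSpace 𝓘(ℝ, F) (c t)), IsSmoothAlong c Y →
    (∀ t, Y t ∈ D.fiber (c t)) → ∀ t, ∃ W ∈ D.fiber (c t), IsCovariantDerivAt g c Y t W

namespace ImmersedSubmanifold

/-- A submanifold is totally geodesic if its second fundamental form vanishes: the ambient covariant
derivative of a vector field tangent to the submanifold, along a curve lying in the submanifold, is
again tangent to it. -/
def IsTotallyGeodesic (S : ImmersedSubmanifold F N) (g : SmoothMetric F N) : Prop :=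
  ∀ (c : ℝ → S.Pt) (Y : ∀ t : ℝ, TangentSpace S.model (c t)), IsSmoothAlong c Y →
    ∀ t, ∃ W ∈ S.tangent (c t),
      IsCovariantDerivAt g (fun s ↦ S.incl (c s)) (fun s ↦ S.dIncl (c s) (Y s)) t W

/-- The submanifold metric. -/
def inducedInner (S : ImmersedSubmanifold F N) (g : SmoothMetric F N) (p : S.Pt)
    (a b : TangentSpace S.model p) : ℝ :=
  g.inner (S.incl p) (S.dIncl p a) (S.dIncl p b)

/-- The submanifold metric is flat: every point has a neighborhood isometric to an open subset of a
Euclidean space. -/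
def IsFlat (S : ImmersedSubmanifold F N) (g : SmoothMetric F N) : Prop :=
  ∀ p : S.Pt, ∃ e ∈ IsManifold.maximalAtlas S.model ∞ S.Pt, p ∈ e.source ∧
    ∀ q ∈ e.source, ∀ a b : TangentSpace S.model q,
      S.inducedInner g q a b =
        @inner ℝ (EuclideanSpace ℝ (Fin S.dim)) _
          (mfderiv S.model S.model e q a) (mfderiv S.model S.model e q b)

end ImmersedSubmanifold

/-- Smooth covering projections: surjective covering maps that are local diffeomorphisms. -/
def IsSmoothCovering {F' : Type*} [NormedAddCommGroup F'] [NormedSpace ℝ F']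
    {N' : Type*} [TopologicalSpace N'] [ChartedSpace F' N'] (f : N' → N) : Prop :=
  Function.Surjective f ∧ IsCoveringMap f ∧ IsLocalDiffeomorph 𝓘(ℝ, F') 𝓘(ℝ, F) ∞ f

end Geometry

section Affine
variable {V E : Type*} [NormedAddCommGroup V] [InnerProductSpace ℝ V]
  [MetricSpace E] [NormedAddTorsor V E]

/-- `L`-subspaces: the subspaces spanned by the elements of `L` they contain. -/
def IsLatticeSubspace (L : AddSubgroup V) (V' : Submodule ℝ V) : Prop :=
  Submodule.span ℝ ((L : Set V) ∩ V') = V'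

/-- The stabilizer of a subset `A` of `E`: all elements of `Γ` mapping `A` onto itself. -/
def setStabilizer (Γ : Subgroup (E ≃ᵃⁱ[ℝ] E)) (A : Set E) : Subgroup (E ≃ᵃⁱ[ℝ] E) where
  carrier := {γ | γ ∈ Γ ∧ γ '' A = A}
  one_mem' := ⟨Γ.one_mem, image_id A⟩
  mul_mem' := by
    rintro a b ⟨ha, hA⟩ ⟨hb, hB⟩
    refine ⟨Γ.mul_mem ha hb, ?_⟩
    rw [AffineIsometryEquiv.coe_mul, image_comp, hB, hA]
  inv_mem' := by
    rintro a ⟨ha, hA⟩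
    refine ⟨Γ.inv_mem ha, ?_⟩
    change a.symm '' A = A
    conv_lhs => rw [← hA]
    rw [← image_comp]
    simp

end Affine

end

/-! Each claim is proved once, for a mapping `ψ : E → N` that is the quotient projection of a group
`Γ` with linear parts preserving `V'`, and that looks in the charts of `N` like an affine isometry
with such a linear part (`IsFlatCover`). The identity of `E` and the projections onto `E / P` and `E
/ L` are all of this kind.

Coordinate changes of `N` are then locally affine isometries preserving `V'`. Hence `V'`, placed in
every tangent space via the preferred chart, is a smooth distribution, onto which the direction
field of the cosets projects. The metric has constant components, so the Christoffel symbols vanish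
and covariant differentiation is ordinary differentiation, which does not lead out of `V'`. This
makes the distribution parallel and its integral manifolds totally geodesic.

For the leaves, let `E'` be a coset of `V'`. An element of `Γ` carrying one point of `E'` into `E'`
preserves `E'`, as its linear part preserves `V'`. So points of `E'` have equal images under `ψ`
exactly when the group `Γ'` of restrictions to `E'` identifies them
(`quotientProj_restrict_eq_iff`). This group is again discrete and torsion-free, and `E' / Γ'`
becomes a connected integral manifold with image `ψ '' E'` (`modelLeaf`).

Conversely, a local lift to `E` of any integral manifold has derivatives with values in `V'`, and so
stays in one coset (`exists_partialDiffeomorph`). An open-closed argument then puts every connected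
integral manifold over a single coset (`range_incl_subset`), which identifies the leaves. For a leaf
`S` with image `ψ '' E'`, the mapping `E' → S` induced by `ψ` is automatically a local
diffeomorphism, and identifies `S` with `E' / Γ'` isometrically. The covering property and flatness
follow.

Compactness comes from the lattice: `V'` has a basis in `L`, and the translates by its integer
combinations of the closed fundamental parallelepiped cover the coset. The same set shows that `Γ'`
is a Bieberbach group. -/

noncomputable section

/-! ### Flat coverings and the distribution they carry -/

section FlatCover

universe u

variable {V E : Type*} [NormedAddCommGroup V] [InnerProductSpace ℝ V]
  [MetricSpace E] [NormedAddTorsor V E]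
  {N : Type u} [TopologicalSpace N] [ChartedSpace V N]

/-- `ψ : E → N` is a quotient projection for the action of `Γ`, given in the charts of `N` by affine
isometries with linear parts that preserve `V'`. -/
structure IsFlatCover (Γ : Subgroup (E ≃ᵃⁱ[ℝ] E)) (V' : Submodule ℝ V) (ψ : E → N) : Prop where
  surjective : Function.Surjective ψ
  eq_iff : ∀ {x y}, ψ x = ψ y ↔ ∃ γ ∈ Γ, γ x = y
  linear_mem_iff : ∀ γ ∈ Γ, ∀ v, γ.linearIsometryEquiv v ∈ V' ↔ v ∈ V'
  exists_coord : ∀ e ∈ atlas V N, ∀ x, ψ x ∈ e.source → ∃ (A : V ≃ₗᵢ[ℝ] V) (b : V),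
    (∀ v, A v ∈ V' ↔ v ∈ V') ∧ ∀ᶠ z in 𝓝 x, ψ z ∈ e.source ∧ e (ψ z) = A (affineChart V E z) + b

theorem affineChart_vadd (v : V) (x : E) : affineChart V E (v +ᵥ x) = v + affineChart V E x :=
  vadd_vsub_assoc _ _ _

theorem affineChart_sub (x y : E) : affineChart V E x - affineChart V E y = x -ᵥ y :=
  vsub_sub_vsub_cancel_right _ _ _

theorem affineChart_symm_vadd (v w : V) :
    (affineChart V E).symm (v + w) = v +ᵥ (affineChart V E).symm w := by
  rw [Homeomorph.symm_apply_eq, affineChart_vadd, Homeomorph.apply_symm_apply]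

namespace IsFlatCover

variable {Γ : Subgroup (E ≃ᵃⁱ[ℝ] E)} {V' : Submodule ℝ V} {ψ : E → N}

/-- One point `x` over `e.symm y` serves both charts. Near it each chart is affine in the affine
coordinate of `E`, and eliminating that coordinate leaves an affine isometry with linear part `A' ∘
A⁻¹`. -/
theorem transition (h : IsFlatCover Γ V' ψ) {e e' : OpenPartialHomeomorph N V}
    (he : e ∈ atlas V N) (he' : e' ∈ atlas V N) {y : V} (hy : y ∈ (e.symm ≫ₕ e').source) :
    ∃ (A : V ≃ₗᵢ[ℝ] V) (b : V), (∀ v, A v ∈ V' ↔ v ∈ V') ∧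
      (e.symm ≫ₕ e') =ᶠ[𝓝 y] fun z ↦ A z + b := by
  have hye : y ∈ e.target := hy.1
  have hye' : e.symm y ∈ e'.source := hy.2
  obtain ⟨x, hx⟩ := h.surjective (e.symm y)
  obtain ⟨A, b, hA, hev⟩ := h.exists_coord e he x (hx ▸ e.map_target hye)
  obtain ⟨A', b', hA', hev'⟩ := h.exists_coord e' he' x (hx ▸ hye')
  set φ := affineChart V E
  have hexy : y = A (φ x) + b := by
    have := hev.self_of_nhds.2
    rwa [hx, e.right_inv hye] at this
  have hc : Continuous fun z ↦ φ.symm (A.symm (z - b)) :=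
    φ.symm.continuous.comp (A.symm.continuous.comp (continuous_id.sub continuous_const))
  have hcx : φ.symm (A.symm (y - b)) = x := by
    rw [hexy]; simp
  have ht : Tendsto (fun z ↦ φ.symm (A.symm (z - b))) (𝓝 y) (𝓝 x) := by
    have := hc.tendsto y
    rwa [hcx] at this
  refine ⟨A.symm.trans A', b' - A' (A.symm b), fun v ↦ ?_, ?_⟩
  · rw [LinearIsometryEquiv.trans_apply, hA', ← hA, LinearIsometryEquiv.apply_symm_apply]
  · filter_upwards [ht.eventually hev, ht.eventually hev'] with z hz hz'
    have h1 : e.symm z = ψ (φ.symm (A.symm (z - b))) := by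
      have h2 : e (ψ (φ.symm (A.symm (z - b)))) = z := by rw [hz.2]; simp
      rw [← e.left_inv hz.1, h2]
    rw [OpenPartialHomeomorph.coe_trans, Function.comp_apply, h1, hz'.2]
    simp [map_sub]
    abel

variable [IsManifold 𝓘(ℝ, V) ∞ N]

/-- This makes both `V'` and the inner product of `V` independent of the chart in which a tangent
space is read. -/
theorem exists_tangentCoordChange (h : IsFlatCover Γ V' ψ)
    {m₁ m₂ m : N} (h₁ : m ∈ (chartAt V m₁).source) (h₂ : m ∈ (chartAt V m₂).source) :
    ∃ A : V ≃ₗᵢ[ℝ] V, (∀ v, A v ∈ V' ↔ v ∈ V') ∧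
      ∀ v : V, tangentCoordChange 𝓘(ℝ, V) m₁ m₂ m v = A v := by
  obtain ⟨A, b, hAV, hA⟩ := h.transition (chart_mem_atlas V m₁) (chart_mem_atlas V m₂)
    (y := chartAt V m₁ m) (by simp [h₁, h₂])
  refine ⟨A, hAV, fun v ↦ ?_⟩
  rw [tangentCoordChange_def]
  have h1 : HasFDerivAt (extChartAt 𝓘(ℝ, V) m₂ ∘ (extChartAt 𝓘(ℝ, V) m₁).symm)
      (A : V →L[ℝ] V) (extChartAt 𝓘(ℝ, V) m₁ m) := by
    refine HasFDerivAt.congr_of_eventuallyEq (f := fun z ↦ A z + b) ?_ ?_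
    · exact (A : V →L[ℝ] V).hasFDerivAt.add_const b
    · simpa using hA
  simp only [modelWithCornersSelf_coe, range_id, fderivWithin_univ]
  rw [h1.fderiv]
  rfl

/-- The distribution of `N` onto which the foliation of `E` by the cosets of `V'` projects. In the
preferred chart at any point its fiber is `V'`. -/
def distribution [FiniteDimensional ℝ V] (h : IsFlatCover Γ V' ψ) : TangentDistribution V N where
  fiber _ := V'
  exists_frame m := by
    let b := Module.finBasis ℝ V'
    -- The frame is a basis of `V'`, kept constant in the chart at `m`.
    refine ⟨_, fun i m' ↦ (trivializationAt V (TangentSpace 𝓘(ℝ, V)) m).symmL ℝ m' (b i : V),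
      (chartAt V m).source, (chartAt V m).open_source, mem_chart_source V m, fun i ↦ ?_, ?_⟩
    · intro m' hm'
      have hm'' : m' ∈ (trivializationAt V (TangentSpace 𝓘(ℝ, V)) m).baseSet := by simpa using hm'
      refine ContMDiffAt.contMDiffWithinAt ?_
      rw [(trivializationAt V (TangentSpace 𝓘(ℝ, V)) m).contMDiffAt_section_iff hm'']
      refine contMDiffAt_const (c := (b i : V)) |>.congr_of_eventuallyEq ?_
      filter_upwards [(chartAt V m).open_source.mem_nhds hm'] with z hz
      have hz' : z ∈ (trivializationAt V (TangentSpace 𝓘(ℝ, V)) m).baseSet := by simpa using hz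
      rw [Bundle.Trivialization.symmL_apply, Bundle.Trivialization.apply_mk_symm _ hz']
      exact hz'
    · intro m' hm'
      -- The fiber at `m'` is read in the chart preferred at `m'`. Relative to it the frame is the
      -- image of the basis under a coordinate change `A` preserving `V'`, hence again a basis of
      -- `V'`.
      obtain ⟨A, hAV, hA⟩ := h.exists_tangentCoordChange hm' (mem_chart_source V m')
      have hs : ∀ u : V,
          ((trivializationAt V (TangentSpace 𝓘(ℝ, V)) m).symmL ℝ m' u : V) = A u := by
        intro u
        rw [TangentBundle.symmL_trivializationAt_eq_core hm']
        exact hA u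
      have hs' : (fun i ↦ ((trivializationAt V (TangentSpace 𝓘(ℝ, V)) m).symmL ℝ m' (b i : V) : V))
          = A.toLinearEquiv.toLinearMap ∘ V'.subtype ∘ b := funext fun i ↦ hs _
      constructor
      · change LinearIndependent ℝ
          (fun i ↦ ((trivializationAt V (TangentSpace 𝓘(ℝ, V)) m).symmL ℝ m' (b i : V) : V))
        rw [hs']
        exact (b.linearIndependent.map' _ V'.ker_subtype).map' _ A.toLinearEquiv.ker
      · have hspan : Submodule.span ℝ (range (A.toLinearEquiv.toLinearMap ∘ V'.subtype ∘ b)) = V' := by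
          rw [range_comp, range_comp, Submodule.span_image, Submodule.span_image, b.span_eq,
            Submodule.map_top, Submodule.range_subtype]
          ext v
          constructor
          · rintro ⟨w, hw, rfl⟩
            exact (hAV w).2 hw
          · intro hv
            exact ⟨A.symm v, (hAV _).1 (by simpa using hv), A.apply_symm_apply v⟩
        exact (congrArg (fun f : _ → V ↦ Submodule.span ℝ (range f)) hs').trans hspan

/-! ### The Levi-Civita connection in flat charts -/

section Derivatives

/-- A vector field along a curve, with values in `V'` in the preferred charts, has a derivative in
`V'`. -/
theorem deriv_mem [FiniteDimensional ℝ V] (h : IsFlatCover Γ V' ψ) {c : ℝ → N}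
    (Y : ∀ t : ℝ, TangentSpace 𝓘(ℝ, V) (c t)) (hY : ∀ t, (Y t : V) ∈ V') (t : ℝ)
    (hc : ContinuousAt c t) :
    deriv (fun s : ℝ ↦ (trivializationAt V (TangentSpace 𝓘(ℝ, V)) (c t) ⟨c s, Y s⟩).2) t ∈ V' := by
  set y := fun s : ℝ ↦ (trivializationAt V (TangentSpace 𝓘(ℝ, V)) (c t) ⟨c s, Y s⟩).2 with hy
  have hev : ∀ᶠ s in 𝓝 t, y s ∈ V' := by
    filter_upwards [hc.preimage_mem_nhds
      ((chartAt V (c t)).open_source.mem_nhds (mem_chart_source V (c t)))] with s hs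
    obtain ⟨A, hAV, hA⟩ := h.exists_tangentCoordChange (mem_chart_source V (c s)) hs
    have : y s = A (Y s) := hA (Y s)
    rw [this]
    exact (hAV _).2 (hY s)
  -- Difference quotients lie in `V'`, which is closed. Where `y` is not differentiable, `deriv`
  -- takes the default value `0`, also in `V'`.
  by_cases hd : DifferentiableAt ℝ y t
  · have h1 : Tendsto (slope y t) (𝓝[≠] t) (𝓝 (deriv y t)) :=
      hasDerivAt_iff_tendsto_slope.mp hd.hasDerivAt
    refine V'.closed_of_finiteDimensional.mem_of_tendsto h1 ?_
    filter_upwards [hev.filter_mono nhdsWithin_le_nhds] with s hs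
    exact V'.smul_mem _ (V'.sub_mem hs hev.self_of_nhds)
  · rw [deriv_zero_of_not_differentiableAt hd]
    exact V'.zero_mem

/-- Vanishing of the Christoffel symbols of a metric with constant components. -/
theorem christoffel_eq_zero (h : IsFlatCover Γ V' ψ) (g : SmoothMetric V N)
    (hg : ∀ (m : N) (a b : V), g.inner m a b = inner ℝ a b) (m : N) (a b z : V) :
    christoffel g m a b z = 0 := by
  have key : ∀ a b : V, (fun p ↦ metricComponents g m p a b) =ᶠ[𝓝 (extChartAt 𝓘(ℝ, V) m m)]
      fun _ ↦ inner ℝ a b := by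
    intro a b
    filter_upwards [(chartAt V m).open_target.mem_nhds
      ((chartAt V m).map_source (mem_chart_source V m))] with p hp
    have hp' : (extChartAt 𝓘(ℝ, V) m).symm p ∈ (chartAt V m).source := by
      simpa using (chartAt V m).map_target hp
    obtain ⟨A, -, hA⟩ := h.exists_tangentCoordChange hp' (mem_chart_source V _)
    have hs : ∀ u : V, ((trivializationAt V (TangentSpace 𝓘(ℝ, V)) m).symmL ℝ
        ((extChartAt 𝓘(ℝ, V) m).symm p) u : V) = A u := by
      intro u
      rw [TangentBundle.symmL_trivializationAt_eq_core hp']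
      exact hA u
    unfold metricComponents
    refine (hg _ _ _).trans ?_
    rw [hs, hs, A.inner_map_map]
  unfold christoffel
  rw [(key b z).fderiv_eq, (key a z).fderiv_eq, (key a b).fderiv_eq]
  simp

/-- With vanishing Christoffel symbols, the ordinary derivative in the chart at `c t` is the
covariant derivative. -/
theorem exists_isCovariantDerivAt [FiniteDimensional ℝ V] (h : IsFlatCover Γ V' ψ)
    (g : SmoothMetric V N) (hg : ∀ (m : N) (a b : V), g.inner m a b = inner ℝ a b) {c : ℝ → N}
    (Y : ∀ t : ℝ, TangentSpace 𝓘(ℝ, V) (c t)) (hY : ∀ t, (Y t : V) ∈ V') (t : ℝ)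
    (hc : ContinuousAt c t) :
    ∃ W : V, W ∈ V' ∧ IsCovariantDerivAt g c Y t W := by
  refine ⟨_, h.deriv_mem Y hY t hc, fun z ↦ ?_⟩
  exact ((congrArg (_ + ·) (h.christoffel_eq_zero g hg _ _ _ _)).trans (add_zero _)).symm

theorem isParallel [FiniteDimensional ℝ V] (h : IsFlatCover Γ V' ψ)
    (g : SmoothMetric V N) (hg : ∀ (m : N) (a b : V), g.inner m a b = inner ℝ a b) :
    h.distribution.IsParallel g := by
  intro c Y hcY hY t
  have hc : Continuous c :=
    (FiberBundle.continuous_proj V (TangentSpace 𝓘(ℝ, V) : N → Type _)).comp hcY.continuous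
  exact h.exists_isCovariantDerivAt g hg Y hY t hc.continuousAt

/-- A field tangent to an integral manifold has ambient values in `V'`, and `V'` is also the tangent
space in which the derivative has to lie. -/
theorem isTotallyGeodesic [FiniteDimensional ℝ V] (h : IsFlatCover Γ V' ψ)
    (g : SmoothMetric V N) (hg : ∀ (m : N) (a b : V), g.inner m a b = inner ℝ a b)
    {S : ImmersedSubmanifold V N} (hS : h.distribution.IsIntegralManifold S) :
    S.IsTotallyGeodesic g := by
  intro c Y hcY t
  have hc : Continuous c :=
    (FiberBundle.continuous_proj _ (TangentSpace S.model : S.Pt → Type _)).comp hcY.continuous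
  have hc' : Continuous fun s ↦ S.incl (c s) := S.contMDiff_incl.continuous.comp hc
  obtain ⟨W, hW, hW'⟩ := h.exists_isCovariantDerivAt g hg (c := fun s ↦ S.incl (c s))
    (fun s ↦ S.dIncl (c s) (Y s)) (fun s ↦ by
      have : S.dIncl (c s) (Y s) ∈ S.tangent (c s) := ⟨_, rfl⟩
      rw [hS] at this
      exact this) t hc'.continuousAt
  refine ⟨W, ?_, hW'⟩
  rw [hS]
  exact hW

end Derivatives

omit [IsManifold 𝓘(ℝ, V) ∞ N] in
/-- The differential of the projection maps `V'` onto `V'`. -/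
theorem exists_hasMFDerivAt (h : IsFlatCover Γ V' ψ) (x : E) (hψ : ContinuousAt ψ x) :
    ∃ A : V ≃ₗᵢ[ℝ] V, (∀ v, A v ∈ V' ↔ v ∈ V') ∧
      HasMFDerivAt 𝓘(ℝ, V) 𝓘(ℝ, V) ψ x (A : V →L[ℝ] V) := by
  obtain ⟨A, b, hAV, hA⟩ := h.exists_coord _ (chart_mem_atlas V (ψ x)) x (mem_chart_source V _)
  refine ⟨A, hAV, hψ, ?_⟩
  refine HasFDerivAt.hasFDerivWithinAt (HasFDerivAt.congr_of_eventuallyEq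
    (f := fun z ↦ A z + b) ((A : V →L[ℝ] V).hasFDerivAt.add_const _) ?_)
  have hc : Tendsto (affineChart V E).symm (𝓝 (affineChart V E x)) (𝓝 x) := by
    have := (affineChart V E).symm.continuous.tendsto (affineChart V E x)
    rwa [Homeomorph.symm_apply_apply] at this
  filter_upwards [hc.eventually hA] with z hz
  have := hz.2
  rw [Homeomorph.apply_symm_apply] at this
  exact this

end IsFlatCover

/-- The trivial group brings `E` and its foliation by cosets under the same lemmas as the quotients.
-/
theorem isFlatCover_id (V' : Submodule ℝ V) : IsFlatCover (⊥ : Subgroup (E ≃ᵃⁱ[ℝ] E)) V' id where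
  surjective := Function.surjective_id
  eq_iff {x y} := by
    constructor
    · intro h; exact ⟨1, rfl, h⟩
    · rintro ⟨γ, rfl, h⟩; exact h
  linear_mem_iff := by
    rintro γ rfl v
    exact Iff.rfl
  exists_coord e he x _ := by
    have : e = (affineChart V E).toOpenPartialHomeomorph :=
      OpenPartialHomeomorph.singletonChartedSpace_mem_atlas_eq _ rfl e he
    subst this
    exact ⟨LinearIsometryEquiv.refl ℝ V, 0, fun _ ↦ Iff.rfl, by simp⟩

theorem quotientProj_eq_iff {Γ : Subgroup (E ≃ᵃⁱ[ℝ] E)} {x y : E} :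
    quotientProj Γ x = quotientProj Γ y ↔ ∃ γ ∈ Γ, γ x = y := by
  constructor
  · intro h
    obtain ⟨γ, hγ⟩ := Quotient.exact h.symm
    exact ⟨γ, γ.2, hγ⟩
  · rintro ⟨γ, hγ, h⟩
    exact (Quotient.sound' (s₁ := MulAction.orbitRel Γ E) ⟨⟨γ, hγ⟩, h⟩).symm

theorem continuous_quotientProj (Γ : Subgroup (E ≃ᵃⁱ[ℝ] E)) : Continuous (quotientProj Γ) :=
  continuous_quotient_mk'

/-- A chart of the quotient inverts a branch of the projection. If `γ` moves `x` to the point of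
that branch over `quotientProj Γ x`, then near `x` the projection followed by the chart is `γ`
followed by the chart of `E`. -/
theorem isFlatCover_quotientProj [FiniteDimensional ℝ V] (Γ : Subgroup (E ≃ᵃⁱ[ℝ] E))
    [IsDiscreteTorsionFree Γ] (V' : Submodule ℝ V)
    (hV' : ∀ γ ∈ Γ, ∀ v, γ.linearIsometryEquiv v ∈ V' ↔ v ∈ V') :
    IsFlatCover Γ V' (quotientProj Γ) where
  surjective := Quotient.mk_surjective
  eq_iff := quotientProj_eq_iff
  linear_mem_iff := hV'
  exists_coord e hea x hxe := by
    set φ := affineChart V E with hφ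
    have h1 : e.symm (e (quotientProj Γ x)) = quotientProj Γ x := e.left_inv hxe
    rw [atlas_symm_apply Γ hea] at h1
    obtain ⟨γ, hγ, hγ'⟩ := quotientProj_eq_iff.1 h1.symm
    refine ⟨γ.linearIsometryEquiv, φ (γ (φ.symm 0)), hV' γ hγ, ?_⟩
    have hmem : φ (γ x) ∈ e.target := by
      rw [hγ', φ.apply_symm_apply]; exact e.map_source hxe
    have hc : Continuous fun z ↦ φ (γ z) := φ.continuous.comp γ.continuous
    filter_upwards [hc.continuousAt.preimage_mem_nhds (e.open_target.mem_nhds hmem)] with z hz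
    have h2 : quotientProj Γ z = e.symm (φ (γ z)) := by
      rw [atlas_symm_apply Γ hea, ← hφ, φ.symm_apply_apply]
      exact quotientProj_eq_iff.2 ⟨γ, hγ, rfl⟩
    refine ⟨h2 ▸ e.map_target hz, ?_⟩
    rw [← affineChart_conj, ← hφ, φ.symm_apply_apply, h2, e.right_inv hz]

theorem linear_mem_iff_of_le [FiniteDimensional ℝ V] (A : V ≃ₗᵢ[ℝ] V) (V' : Submodule ℝ V)
    (h : ∀ v ∈ V', A v ∈ V') (v : V) : A v ∈ V' ↔ v ∈ V' := by
  refine ⟨fun hv ↦ ?_, h v⟩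
  have h1 : V'.map A.toLinearEquiv.toLinearMap = V' :=
    Submodule.eq_of_le_of_finrank_eq (by rintro _ ⟨w, hw, rfl⟩; exact h w hw)
      (LinearEquiv.finrank_map_eq A.toLinearEquiv V')
  rw [← h1] at hv
  obtain ⟨w, hw, hwv⟩ := hv
  rwa [← A.injective hwv]

end FlatCover

end

/-! ### Local structure of integral manifolds -/

noncomputable section

/-- The inverse function theorem, for smooth mappings. -/
theorem ContDiffOn.exists_openPartialHomeomorph {X Y : Type*} [NormedAddCommGroup X]
    [NormedSpace ℝ X] [CompleteSpace X] [NormedAddCommGroup Y] [NormedSpace ℝ Y] [CompleteSpace Y]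
    {f : X → Y} {U : Set X} (hf : ContDiffOn ℝ ∞ f U) (hU : IsOpen U)
    (hbij : ∀ u ∈ U, Function.Bijective (fderiv ℝ f u)) {a : X} (ha : a ∈ U) :
    ∃ e : OpenPartialHomeomorph X Y, a ∈ e.source ∧ e.source ⊆ U ∧ (∀ u, e u = f u) ∧
      ContDiffOn ℝ ∞ e e.source ∧ ContDiffOn ℝ ∞ e.symm e.target := by
  have hfa : ∀ u ∈ U, ContDiffAt ℝ ∞ f u := fun u hu ↦ hf.contDiffAt (hU.mem_nhds hu)
  have hequiv : ∀ u ∈ U, ∃ f' : X ≃L[ℝ] Y, HasFDerivAt f (f' : X →L[ℝ] Y) u := by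
    intro u hu
    refine ⟨ContinuousLinearEquiv.ofBijective (fderiv ℝ f u)
      (LinearMap.ker_eq_bot.2 (hbij u hu).1) (LinearMap.range_eq_top.2 (hbij u hu).2), ?_⟩
    rw [ContinuousLinearEquiv.coe_ofBijective]
    exact ((hfa u hu).differentiableAt (by simp)).hasFDerivAt
  obtain ⟨f', hf'⟩ := hequiv a ha
  let e₀ := (hfa a ha).toOpenPartialHomeomorph f hf' (by simp)
  have he₀ : (e₀ : X → Y) = f := (hfa a ha).toOpenPartialHomeomorph_coe hf' (by simp)
  have hmem : a ∈ e₀.source := (hfa a ha).mem_toOpenPartialHomeomorph_source hf' (by simp)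
  have hsU : (e₀.restrOpen U hU).source ⊆ U := fun u hu ↦ hu.2
  have he : ∀ u, e₀.restrOpen U hU u = f u := fun u ↦ congrFun he₀ u
  refine ⟨e₀.restrOpen U hU, ⟨hmem, ha⟩, hsU, he, ?_, ?_⟩
  · exact (hf.mono hsU).congr fun u _ ↦ he u
  · intro y hy
    -- Smoothness of the inverse at `y` needs an invertible derivative at the preimage of `y`, not
    -- only at `a`; this is why the source was cut down to `U`.
    have hyU := hsU ((e₀.restrOpen U hU).map_target hy)
    obtain ⟨g', hg'⟩ := hequiv _ hyU
    refine ContDiffAt.contDiffWithinAt ((e₀.restrOpen U hU).contDiffAt_symm hy (f₀' := g') ?_ ?_)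
    · rwa [show ((e₀.restrOpen U hU : OpenPartialHomeomorph X Y) : X → Y) = f from funext he]
    · rw [show ((e₀.restrOpen U hU : OpenPartialHomeomorph X Y) : X → Y) = f from funext he]
      exact hfa _ hyU

section Affine

variable {V E : Type*} [NormedAddCommGroup V] [InnerProductSpace ℝ V]
  [MetricSpace E] [NormedAddTorsor V E]
  {V₁ E₁ : Type*} [NormedAddCommGroup V₁] [InnerProductSpace ℝ V₁]
  [MetricSpace E₁] [NormedAddTorsor V₁ E₁]

/-- The global chart of a Euclidean affine space with a given origin. -/
def vsubDiffeomorph (o : E) : Diffeomorph 𝓘(ℝ, V) 𝓘(ℝ, V) E V ∞ where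
  toEquiv := (Equiv.vaddConst o).symm
  contMDiff_toFun := by
    have h1 : ContMDiff 𝓘(ℝ, V) 𝓘(ℝ, V) ∞ (affineChart V E) :=
      contMDiffOn_univ.1 (contMDiffOn_chart (H := V) (x := o))
    have h2 : ContMDiff 𝓘(ℝ, V) 𝓘(ℝ, V) ∞ fun v : V ↦ v - affineChart V E o :=
      (contDiff_id.sub contDiff_const).contMDiff
    refine (h2.comp h1).congr fun x ↦ ?_
    exact (affineChart_sub x o).symm
  contMDiff_invFun := by
    have h1 : ContMDiff 𝓘(ℝ, V) 𝓘(ℝ, V) ∞ (affineChart V E).symm :=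
      contMDiffOn_univ.1 (contMDiffOn_chart_symm (H := V) (x := o))
    have h2 : ContMDiff 𝓘(ℝ, V) 𝓘(ℝ, V) ∞ fun v : V ↦ v + affineChart V E o :=
      (contDiff_id.add contDiff_const).contMDiff
    refine (h1.comp h2).congr fun v ↦ ?_
    change v +ᵥ o = (affineChart V E).symm (v + affineChart V E o)
    rw [affineChart_symm_vadd, Homeomorph.symm_apply_apply]

theorem AffineIsometry.affineChart_conj (j : E₁ →ᵃⁱ[ℝ] E) (y : V₁) :
    affineChart V E (j ((affineChart V₁ E₁).symm y)) =
      j.linearIsometry y + affineChart V E (j ((affineChart V₁ E₁).symm 0)) := by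
  have h : (affineChart V₁ E₁).symm y = y +ᵥ (affineChart V₁ E₁).symm 0 := by
    rw [← affineChart_symm_vadd, add_zero]
  rw [h, j.map_vadd, affineChart_vadd]

theorem AffineIsometry.contMDiff (j : E₁ →ᵃⁱ[ℝ] E) : ContMDiff 𝓘(ℝ, V₁) 𝓘(ℝ, V) ∞ j := by
  intro x
  refine ⟨j.continuous.continuousWithinAt, ContDiffAt.contDiffWithinAt ?_⟩
  have : ContDiff ℝ ∞ fun y ↦ j.linearIsometry y + affineChart V E (j ((affineChart V₁ E₁).symm 0)) :=
    j.linearIsometry.contDiff.add contDiff_const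
  exact this.contDiffAt.congr_of_eventuallyEq (Eventually.of_forall fun y ↦ j.affineChart_conj y)

theorem AffineIsometry.hasMFDerivAt (j : E₁ →ᵃⁱ[ℝ] E) (x : E₁) :
    HasMFDerivAt 𝓘(ℝ, V₁) 𝓘(ℝ, V) j x j.linearIsometry.toContinuousLinearMap := by
  refine ⟨j.continuous.continuousAt, HasFDerivAt.hasFDerivWithinAt ?_⟩
  have : HasFDerivAt (fun y ↦ j.linearIsometry y + affineChart V E (j ((affineChart V₁ E₁).symm 0)))
      j.linearIsometry.toContinuousLinearMap (affineChart V₁ E₁ x) :=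
    j.linearIsometry.toContinuousLinearMap.hasFDerivAt.add_const _
  exact this.congr_of_eventuallyEq (Eventually.of_forall fun y ↦ j.affineChart_conj y)

theorem vsubDiffeomorph_hasMFDerivAt (o x : E) :
    HasMFDerivAt 𝓘(ℝ, V) 𝓘(ℝ, V) (vsubDiffeomorph o) x (ContinuousLinearMap.id ℝ V) := by
  refine ⟨(vsubDiffeomorph o).continuous.continuousAt, HasFDerivAt.hasFDerivWithinAt ?_⟩
  have : HasFDerivAt (fun y : V ↦ y - affineChart V E o)
      (ContinuousLinearMap.id ℝ V) (affineChart V E x) := (hasFDerivAt_id _).sub_const _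
  refine this.congr_of_eventuallyEq (Eventually.of_forall fun y ↦ ?_)
  change (affineChart V E).symm y -ᵥ o = _
  rw [← affineChart_sub, Homeomorph.apply_symm_apply]

end Affine

universe u

variable {V E : Type*} [NormedAddCommGroup V] [InnerProductSpace ℝ V]
  [MetricSpace E] [NormedAddTorsor V E]
  {N : Type u} [TopologicalSpace N] [ChartedSpace V N] [IsManifold 𝓘(ℝ, V) ∞ N]
  {V₁ E₁ : Type*} [NormedAddCommGroup V₁] [InnerProductSpace ℝ V₁]
  [MetricSpace E₁] [NormedAddTorsor V₁ E₁]

namespace IsFlatCover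

variable {Γ : Subgroup (E ≃ᵃⁱ[ℝ] E)} {V' : Submodule ℝ V} {ψ : E → N} [FiniteDimensional ℝ V]

/-- In charts, an integral manifold is an immersion with tangent spaces `V'`. -/
theorem coord_fderiv (h : IsFlatCover Γ V' ψ) {S : ImmersedSubmanifold V N}
    (hS : h.distribution.IsIntegralManifold S) (p : S.Pt)
    {u : EuclideanSpace ℝ (Fin S.dim)} (hu : u ∈ (chartAt (EuclideanSpace ℝ (Fin S.dim)) p).target)
    (hu' : S.incl ((chartAt (EuclideanSpace ℝ (Fin S.dim)) p).symm u) ∈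
      (chartAt V (S.incl p)).source) :
    Function.Injective (fderiv ℝ (fun w ↦ chartAt V (S.incl p)
        (S.incl ((chartAt (EuclideanSpace ℝ (Fin S.dim)) p).symm w))) u) ∧
      range (fderiv ℝ (fun w ↦ chartAt V (S.incl p)
        (S.incl ((chartAt (EuclideanSpace ℝ (Fin S.dim)) p).symm w))) u) = (V' : Set V) := by
  set c := chartAt (EuclideanSpace ℝ (Fin S.dim)) p with hc
  have hcd : c.MDifferentiable S.model S.model := mdifferentiable_chart p
  set q := c.symm u with hq
  -- The three differentials are named as mappings of fixed model spaces, so that the composition is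
  -- free of tangent spaces depending on the point.
  obtain ⟨C, hC⟩ : ∃ C : EuclideanSpace ℝ (Fin S.dim) →L[ℝ] EuclideanSpace ℝ (Fin S.dim),
    C = mfderiv S.model S.model c.symm u := ⟨_, rfl⟩
  obtain ⟨G, hG⟩ : ∃ G : EuclideanSpace ℝ (Fin S.dim) →L[ℝ] V, G = S.dIncl q := ⟨_, rfl⟩
  obtain ⟨T, hT⟩ : ∃ T : V →L[ℝ] V,
    T = mfderiv 𝓘(ℝ, V) 𝓘(ℝ, V) (chartAt V (S.incl p)) (S.incl q) := ⟨_, rfl⟩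
  have h1 : HasMFDerivAt S.model S.model c.symm u C := by
    rw [hC]
    exact (hcd.mdifferentiableAt_symm hu).hasMFDerivAt
  have h2 : HasMFDerivAt S.model 𝓘(ℝ, V) S.incl q G := by
    rw [hG]
    exact ((S.contMDiff_incl q).mdifferentiableAt (by simp)).hasMFDerivAt
  have h3 : HasMFDerivAt 𝓘(ℝ, V) 𝓘(ℝ, V) (chartAt V (S.incl p)) (S.incl q) T := by
    rw [hT]
    exact ((mdifferentiable_chart (I := 𝓘(ℝ, V)) (S.incl p)).mdifferentiableAt hu').hasMFDerivAt
  have h4 : HasFDerivAt (fun w ↦ chartAt V (S.incl p) (S.incl (c.symm w))) (T.comp (G.comp C)) u :=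
    hasMFDerivAt_iff_hasFDerivAt.1 (h3.comp u (h2.comp u h1))
  rw [h4.fderiv]
  -- The tangent space at `S.incl q` is read in the chart preferred there, so the differential `T`
  -- of the chart at `S.incl p` is a coordinate change, and preserves `V'`.
  obtain ⟨A, hAV, hA⟩ := h.exists_tangentCoordChange (mem_chart_source V (S.incl q)) hu'
  have hTA : ∀ v, T v = A v := by
    intro v
    rw [← hA v, hT]
    exact congrArg (fun f : V →L[ℝ] V ↦ f v) (mfderiv_chartAt_eq_tangentCoordChange hu')
  have hbij : Function.Bijective C := hC ▸ hcd.symm.mfderiv_bijective hu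
  have hGinj : Function.Injective G := hG ▸ S.mfderiv_incl_injective q
  have hGV : ∀ w : V, w ∈ V' ↔ ∃ v, G v = w := by
    intro w
    rw [hG]
    exact (SetLike.ext_iff.1 (hS q) w).symm
  constructor
  · intro v w hvw
    change T (G (C v)) = T (G (C w)) at hvw
    rw [hTA, hTA] at hvw
    exact hbij.1 (hGinj (A.injective hvw))
  · ext w
    constructor
    · rintro ⟨v, rfl⟩
      change T (G (C v)) ∈ V'
      rw [hTA]
      exact (hAV _).2 ((hGV _).2 ⟨_, rfl⟩)
    · intro hw
      obtain ⟨v, hv⟩ := (hGV (A.symm w)).1 ((hAV _).1 (by simpa using hw))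
      obtain ⟨v', rfl⟩ := hbij.2 v
      refine ⟨v', ?_⟩
      change T (G (C v')) = w
      rw [hTA, hv, A.apply_symm_apply]

variable [FiniteDimensional ℝ V₁]

/-- An integral manifold is parametrized by the cosets of `V'`, locally around any given point. -/
theorem exists_partialDiffeomorph (h : IsFlatCover Γ V' ψ) {S : ImmersedSubmanifold V N}
    (hS : h.distribution.IsIntegralManifold S) (j : E₁ →ᵃⁱ[ℝ] E)
    (hj : range j.linearIsometry = (V' : Set V)) {x : E₁} {p : S.Pt} (hxp : S.incl p = ψ (j x)) :
    ∃ Φ : PartialDiffeomorph 𝓘(ℝ, V₁) S.model E₁ S.Pt ∞, x ∈ Φ.source ∧ Φ x = p ∧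
      ∀ z ∈ Φ.source, S.incl (Φ z) = ψ (j z) := by
  have : CompleteSpace V := FiniteDimensional.complete ℝ V
  have : CompleteSpace V₁ := FiniteDimensional.complete ℝ V₁
  set c := chartAt (EuclideanSpace ℝ (Fin S.dim)) p with hc
  set e := chartAt V (S.incl p) with he
  have hpe : S.incl p ∈ e.source := mem_chart_source V _
  have hpc : p ∈ c.source := mem_chart_source _ _
  obtain ⟨A, b, hAV, hA⟩ := h.exists_coord e (chart_mem_atlas V _) (j x) (hxp ▸ hpe)
  -- A left inverse of the linear part of `j` provides coordinates in `V₁` for the vectors of `V'`.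
  obtain ⟨g₀, hg₀⟩ := j.linearIsometry.toLinearMap.exists_leftInverse_of_injective
    (LinearMap.ker_eq_bot.2 j.linearIsometry.injective)
  set J := j.linearIsometry.toContinuousLinearMap with hJ
  set g : V →L[ℝ] V₁ := g₀.toContinuousLinearMap with hg
  have hgJ : ∀ v, g (J v) = v := fun v ↦ LinearMap.congr_fun hg₀ v
  have hJg : ∀ v ∈ V', J (g v) = v := by
    intro v hv
    have hv' : v ∈ range j.linearIsometry := hj ▸ hv
    obtain ⟨w, rfl⟩ := hv'
    exact congrArg J (hgJ w)
  -- the mapping of the parameter space into `V`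
  set k := fun w ↦ e (S.incl (c.symm w)) with hk
  set U₀ := c.target ∩ c.symm ⁻¹' (S.incl ⁻¹' e.source) with hU₀
  have hU₀o : IsOpen U₀ := c.symm.isOpen_inter_preimage
    (e.open_source.preimage S.contMDiff_incl.continuous)
  have hkU : ContDiffOn ℝ ∞ k U₀ := by
    have := (contMDiff_iff.1 S.contMDiff_incl).2 p (S.incl p)
    simp only [mfld_simps] at this
    exact this
  -- Undoing `z ↦ A z + b` turns chart coordinates in `N` into affine coordinates of a lift to `E`.
  set κ := fun w ↦ A.symm (k w - b) with hκ
  have hκU : ContDiffOn ℝ ∞ κ U₀ := A.symm.contDiff.comp_contDiffOn (hkU.sub contDiffOn_const)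
  have hpU₀ : c p ∈ U₀ := ⟨c.map_source hpc, by
    change S.incl (c.symm (c p)) ∈ e.source
    rwa [c.left_inv hpc]⟩
  have hκp : κ (c p) = affineChart V E (j x) := by
    change A.symm (e (S.incl (c.symm (c p))) - b) = _
    rw [c.left_inv hpc, hxp, hA.self_of_nhds.2]
    simp
  have hκd : ∀ w ∈ U₀, ∃ D : EuclideanSpace ℝ (Fin S.dim) →L[ℝ] V, HasFDerivAt κ D w ∧
      Function.Injective D ∧ range D = (V' : Set V) := by
    intro w hw
    obtain ⟨hinj, hran⟩ := h.coord_fderiv hS p hw.1 hw.2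
    have hkd : HasFDerivAt k (fderiv ℝ k w) w :=
      ((hkU.contDiffAt (hU₀o.mem_nhds hw)).differentiableAt (by simp)).hasFDerivAt
    refine ⟨(A.symm : V →L[ℝ] V).comp (fderiv ℝ k w),
      (A.symm : V →L[ℝ] V).hasFDerivAt.comp w (hkd.sub_const b), ?_, ?_⟩
    · exact A.symm.injective.comp hinj
    · rw [ContinuousLinearMap.coe_comp, range_comp, hran]
      ext v
      constructor
      · rintro ⟨v', hv', rfl⟩
        exact (hAV _).1 (by simpa using hv')
      · intro hv
        exact ⟨A v, (hAV v).2 hv, A.symm_apply_apply v⟩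
  -- a ball in the parameter space on which everything is defined
  have hcont : ContinuousAt κ (c p) := hκU.continuousOn.continuousAt (hU₀o.mem_nhds hpU₀)
  -- This is the lift with affine coordinates `κ w`, written as a translate of `j x`; for `w` close
  -- to `c p` it is so close to `j x` that `hA` applies.
  have htend : Tendsto (fun w ↦ (κ w - κ (c p)) +ᵥ j x) (𝓝 (c p)) (𝓝 (j x)) := by
    have h1 : ContinuousAt (fun w ↦ (κ w - κ (c p)) +ᵥ j x) (c p) :=
      (hcont.sub continuousAt_const).vadd continuousAt_const
    simpa [ContinuousAt] using h1
  obtain ⟨r, hr, hball⟩ := Metric.mem_nhds_iff.1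
    (inter_mem (hU₀o.mem_nhds hpU₀) (htend.eventually hA))
  set U := Metric.ball (c p) r with hU
  have hUU₀ : U ⊆ U₀ := fun w hw ↦ (hball hw).1
  have hpU : c p ∈ U := Metric.mem_ball_self hr
  have hκV : ∀ w ∈ U, κ w - κ (c p) ∈ V' := by
    intro w hw
    -- `Q` has kernel `V'`, and the derivatives of `κ` take values in `V'`. So `Q ∘ κ` has zero
    -- derivative, and is constant on the ball: the lift stays in one coset.
    set Q : V →L[ℝ] V := ContinuousLinearMap.id ℝ V - J.comp g with hQ
    have hQκ : ∀ w ∈ U, HasFDerivAt (fun w ↦ Q (κ w)) (0 : _ →L[ℝ] V) w := by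
      intro w hw
      obtain ⟨D, hD, -, hran⟩ := hκd w (hUU₀ hw)
      have h1 := Q.hasFDerivAt.comp w hD
      have h2 : Q.comp D = 0 := by
        ext1 v
        have : D v ∈ V' := by
          have : D v ∈ range D := ⟨v, rfl⟩
          rwa [hran] at this
        simp [hQ, hJg _ this]
      rwa [h2] at h1
    have h3 := Metric.isOpen_ball.is_const_of_fderiv_eq_zero (𝕜 := ℝ)
      (convex_ball (c p) r).isPreconnected
      (fun w hw ↦ (hQκ w hw).differentiableAt.differentiableWithinAt)
      (fun w hw ↦ (hQκ w hw).fderiv) hw hpU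
    have h4 : κ w - κ (c p) = J (g (κ w - κ (c p))) := by
      have h5 : Q (κ w - κ (c p)) = 0 := by rw [map_sub]; exact sub_eq_zero.2 h3
      exact sub_eq_zero.1 h5
    rw [h4]
    have h6 : J (g (κ w - κ (c p))) ∈ range j.linearIsometry := ⟨_, rfl⟩
    rwa [hj] at h6
  set σ := fun w ↦ g (κ w - κ (c p)) with hσ
  have hσU : ContDiffOn ℝ ∞ σ U := g.contDiff.comp_contDiffOn ((hκU.mono hUU₀).sub contDiffOn_const)
  have hσbij : ∀ w ∈ U, Function.Bijective (fderiv ℝ σ w) := by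
    intro w hw
    obtain ⟨D, hD, hinj, hran⟩ := hκd w (hUU₀ hw)
    have hmem : ∀ v, D v ∈ V' := fun v ↦ by
      have : D v ∈ range D := ⟨v, rfl⟩
      rwa [hran] at this
    have h1 : HasFDerivAt σ (g.comp D) w := g.hasFDerivAt.comp w (hD.sub_const _)
    rw [h1.fderiv]
    constructor
    · intro v v' hvv
      apply hinj
      rw [← hJg _ (hmem v), ← hJg _ (hmem v')]
      exact congrArg J hvv
    · intro v
      have h2 : J v ∈ range D := by
        rw [hran, ← hj]
        exact ⟨v, rfl⟩
      obtain ⟨w', hw'⟩ := h2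
      exact ⟨w', (congrArg g hw').trans (hgJ v)⟩
  have hσψ : ∀ w ∈ U, S.incl (c.symm w) = ψ (j (σ w +ᵥ x)) := by
    intro w hw
    obtain ⟨hw0, hz, hz'⟩ := hball hw
    have h1 : j (σ w +ᵥ x) = (κ w - κ (c p)) +ᵥ j x := by
      rw [j.map_vadd]
      exact congrArg (· +ᵥ j x) (hJg _ (hκV w hw))
    rw [h1]
    -- Both points lie in the domain of `e`, where equality can be tested in coordinates.
    refine e.injOn hw0.2 hz ?_
    rw [hz', affineChart_vadd, ← hκp, sub_add_cancel, hκ]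
    simp [hk]
  obtain ⟨ε, hpε, hεU, hεσ, hεs, hεt⟩ :=
    hσU.exists_openPartialHomeomorph Metric.isOpen_ball hσbij hpU
  let Ψ₁ : PartialDiffeomorph 𝓘(ℝ, V₁) S.model V₁ (EuclideanSpace ℝ (Fin S.dim)) ∞ :=
    { toPartialEquiv := ε.symm.toPartialEquiv
      open_source := ε.open_target
      open_target := ε.open_source
      contMDiffOn_toFun := hεt.contMDiffOn
      contMDiffOn_invFun := hεs.contMDiffOn }
  let Ψ₂ : PartialDiffeomorph S.model S.model (EuclideanSpace ℝ (Fin S.dim)) S.Pt ∞ :=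
    { toPartialEquiv := c.symm.toPartialEquiv
      open_source := c.open_target
      open_target := c.open_source
      contMDiffOn_toFun := contMDiffOn_chart_symm
      contMDiffOn_invFun := contMDiffOn_chart }
  have hσp : ε (c p) = x -ᵥ x := by rw [hεσ, hσ]; simp
  refine ⟨((vsubDiffeomorph x).toPartialDiffeomorph.trans Ψ₁).trans Ψ₂, ?_, ?_, ?_⟩
  · refine ⟨⟨mem_univ x, ?_⟩, ?_⟩
    · change x -ᵥ x ∈ ε.target
      rw [← hσp]
      exact ε.map_source hpε
    · change ε.symm (x -ᵥ x) ∈ c.target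
      rw [← hσp, ε.left_inv hpε]
      exact c.map_source hpc
  · change c.symm (ε.symm (x -ᵥ x)) = p
    rw [← hσp, ε.left_inv hpε, c.left_inv hpc]
  · rintro z ⟨⟨-, hz⟩, hz'⟩
    change z -ᵥ x ∈ ε.target at hz
    change S.incl (c.symm (ε.symm (z -ᵥ x))) = ψ (j z)
    rw [hσψ _ (hεU (ε.map_target hz)), ← hεσ, ε.right_inv hz, vsub_vadd]

end IsFlatCover

end

/-! ### Groups induced on cosets -/

noncomputable section

section Restriction

variable {V E : Type*} [NormedAddCommGroup V] [InnerProductSpace ℝ V]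
  [MetricSpace E] [NormedAddTorsor V E]
  {V₁ E₁ : Type*} [NormedAddCommGroup V₁] [InnerProductSpace ℝ V₁]
  [MetricSpace E₁] [NormedAddTorsor V₁ E₁]

/-- The isometries of `E₁` induced, under an isometric embedding `j : E₁ → E`, by the elements of `Γ`
that preserve the image of `j`. -/
def restrictSubgroup (Γ : Subgroup (E ≃ᵃⁱ[ℝ] E)) (j : E₁ →ᵃⁱ[ℝ] E) : Subgroup (E₁ ≃ᵃⁱ[ℝ] E₁) where
  carrier := {γ' | ∃ γ ∈ Γ, ∀ x, j (γ' x) = γ (j x)}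
  one_mem' := ⟨1, Γ.one_mem, fun _ ↦ rfl⟩
  mul_mem' := by
    rintro a b ⟨a', ha, hj⟩ ⟨b', hb, hj'⟩
    refine ⟨a' * b', Γ.mul_mem ha hb, fun x ↦ ?_⟩
    change j (a (b x)) = a' (b' (j x))
    rw [hj, hj']
  inv_mem' := by
    rintro a ⟨a', ha, hj⟩
    refine ⟨a'⁻¹, Γ.inv_mem ha, fun x ↦ ?_⟩
    change j (a.symm x) = a'.symm (j x)
    rw [AffineIsometryEquiv.eq_symm_apply, ← hj, AffineIsometryEquiv.apply_symm_apply]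

theorem linearIsometry_restrict {j : E₁ →ᵃⁱ[ℝ] E} {γ' : E₁ ≃ᵃⁱ[ℝ] E₁} {γ : E ≃ᵃⁱ[ℝ] E}
    (h : ∀ x, j (γ' x) = γ (j x)) (v : V₁) :
    j.linearIsometry (γ'.linearIsometryEquiv v) = γ.linearIsometryEquiv (j.linearIsometry v) := by
  obtain ⟨x⟩ : Nonempty E₁ := inferInstance
  have h1 := h (v +ᵥ x)
  rw [γ'.map_vadd, j.map_vadd, j.map_vadd, γ.map_vadd, h] at h1
  exact vadd_right_cancel _ h1

/-- An isometry of `E` that preserves the direction of the image of `j`, and maps some point of that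
image into the image, induces an isometry. -/
theorem exists_restrict [FiniteDimensional ℝ V₁] {V' : Submodule ℝ V} {j : E₁ →ᵃⁱ[ℝ] E}
    (hj : range j.linearIsometry = (V' : Set V)) {γ : E ≃ᵃⁱ[ℝ] E}
    (hγ : ∀ v ∈ V', γ.linearIsometryEquiv v ∈ V') {x y : E₁} (hxy : γ (j x) = j y) :
    ∃ γ' : E₁ ≃ᵃⁱ[ℝ] E₁, ∀ z, j (γ' z) = γ (j z) := by
  have h1 : ∀ v : V₁, ∃ w, j.linearIsometry w = γ.linearIsometryEquiv (j.linearIsometry v) := by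
    intro v
    have h2 : γ.linearIsometryEquiv (j.linearIsometry v) ∈ (V' : Set V) :=
      hγ _ (hj.subset (mem_range_self v))
    rwa [← hj] at h2
  choose B hB using h1
  let B' : V₁ →ₗᵢ[ℝ] V₁ :=
    { toFun := B
      map_add' := fun v w ↦ j.linearIsometry.injective (by simp [hB])
      map_smul' := fun c v ↦ j.linearIsometry.injective (by simp [hB])
      norm_map' := fun v ↦ by
        change ‖B v‖ = ‖v‖
        rw [← j.linearIsometry.norm_map (B v), hB]
        simp }
  -- By equality of dimensions, a linear isometry of `V₁` into itself is onto.
  let B'' : V₁ ≃ₗᵢ[ℝ] V₁ := B'.toLinearIsometryEquiv rfl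
  refine ⟨((AffineIsometryEquiv.vaddConst ℝ x).symm.trans B''.toAffineIsometryEquiv).trans
    (AffineIsometryEquiv.vaddConst ℝ y), fun z ↦ ?_⟩
  change j (B (z -ᵥ x) +ᵥ y) = γ (j z)
  rw [j.map_vadd, hB, ← hxy, ← γ.map_vadd, ← j.map_vadd, vsub_vadd]

instance : IsDiscreteTorsionFree (⊥ : Subgroup (E ≃ᵃⁱ[ℝ] E)) where
  discrete := inferInstance
  torsionFree _ hγ _ := hγ

/-- Points of an orbit do not come close to each other. -/
theorem exists_dist_lt_eq_one [FiniteDimensional ℝ V] (Γ : Subgroup (E ≃ᵃⁱ[ℝ] E))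
    [IsDiscreteTorsionFree Γ] (x : E) : ∃ δ > 0, ∀ γ ∈ Γ, dist (γ x) x < δ → γ = 1 := by
  have hfin := ProperlyDiscontinuousSMul.finite_disjoint_inter_image (Γ := Γ)
    (isCompact_singleton (x := x)) (isCompact_closedBall x 1)
  -- The orbit points other than `x` at distance at most 1 from `x` form a finite, hence closed,
  -- set, which some ball around `x` avoids. The minimum with 1 below restricts attention to these
  -- orbit points.
  have hfin' := (hfin.image fun γ : Γ ↦ γ • x).subset (sdiff_subset (t := {x}))
  obtain ⟨δ, hδ, hball⟩ := Metric.mem_nhds_iff.1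
    (hfin'.isClosed.isOpen_compl.mem_nhds fun hx ↦ hx.2 rfl)
  refine ⟨min δ 1, lt_min hδ one_pos, fun γ hγ hd ↦ ?_⟩
  have hfix : γ x = x := by
    by_contra hne
    exact hball (hd.trans_le (min_le_left _ _)) ⟨⟨⟨γ, hγ⟩, ⟨γ x, ⟨x, rfl, rfl⟩,
      (hd.trans_le (min_le_right _ _)).le⟩, rfl⟩, hne⟩
  have h1 : (⟨γ, hγ⟩ : Γ) = 1 := IsCancelSMul.right_cancel (⟨γ, hγ⟩ : Γ) 1 x
    (hfix.trans (one_smul Γ x).symm)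
  exact congrArg Subtype.val h1

theorem eq_one_of_apply_eq [FiniteDimensional ℝ V] {Γ : Subgroup (E ≃ᵃⁱ[ℝ] E)}
    [IsDiscreteTorsionFree Γ] {γ : E ≃ᵃⁱ[ℝ] E} (hγ : γ ∈ Γ) {x : E} (h : γ x = x) : γ = 1 := by
  obtain ⟨δ, hδ, hx⟩ := exists_dist_lt_eq_one Γ x
  exact hx γ hγ (by rwa [h, dist_self])

/-- A single point detects discreteness: if `β x` is within `δ` of `α x`, then an element of `Γ`
inducing `α⁻¹ * β` moves `j x` by less than `δ`, and so is trivial. If `α ^ n = 1`, then the `n`th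
power of an element inducing `α` fixes `j x`, and freeness reduces the question to torsion in `Γ`.
-/
instance [FiniteDimensional ℝ V] (Γ : Subgroup (E ≃ᵃⁱ[ℝ] E)) [hΓ : IsDiscreteTorsionFree Γ]
    (j : E₁ →ᵃⁱ[ℝ] E) : IsDiscreteTorsionFree (restrictSubgroup Γ j) where
  discrete := by
    obtain ⟨x⟩ : Nonempty E₁ := inferInstance
    obtain ⟨δ, hδ, hx⟩ := exists_dist_lt_eq_one Γ (j x)
    refine discreteTopology_iff_isOpen_singleton.2 fun α ↦ ?_
    have hcont : Continuous fun γ : restrictSubgroup Γ j ↦ (γ : E₁ ≃ᵃⁱ[ℝ] E₁) x :=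
      ((continuous_apply x).comp continuous_induced_dom).comp continuous_subtype_val
    convert Metric.isOpen_ball.preimage hcont (t := Metric.ball ((α : E₁ ≃ᵃⁱ[ℝ] E₁) x) δ) using 1
    ext β
    constructor
    · rintro rfl
      exact Metric.mem_ball_self hδ
    · intro hβ
      obtain ⟨γ, hγ, hγ'⟩ := (α⁻¹ * β).2
      have h1 : γ = 1 := by
        refine hx γ hγ ?_
        rw [← hγ', j.dist_map]
        have h2 := (α : E₁ ≃ᵃⁱ[ℝ] E₁).dist_map (((α⁻¹ * β : restrictSubgroup Γ j) :
          E₁ ≃ᵃⁱ[ℝ] E₁) x) x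
        rw [← h2]
        change dist ((α : E₁ ≃ᵃⁱ[ℝ] E₁) ((α : E₁ ≃ᵃⁱ[ℝ] E₁).symm ((β : E₁ ≃ᵃⁱ[ℝ] E₁) x))) _ < δ
        rw [AffineIsometryEquiv.apply_symm_apply]
        exact hβ
      have h3 : α⁻¹ * β = 1 := by
        ext z
        refine j.injective ?_
        rw [hγ', h1]
        rfl
      exact (inv_mul_eq_one.1 h3).symm
  torsionFree := by
    rintro α ⟨γ, hγ, h⟩ hα
    obtain ⟨n, hn, hαn⟩ := isOfFinOrder_iff_pow_eq_one.1 hα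
    have hpow : ∀ (k : ℕ) (z : E₁), j ((α ^ k) z) = (γ ^ k) (j z) := by
      intro k
      induction k with
      | zero => intro z; rfl
      | succ k ih =>
        intro z
        rw [pow_succ, pow_succ]
        change j ((α ^ k) (α z)) = (γ ^ k) (γ (j z))
        rw [ih, h]
    obtain ⟨x⟩ : Nonempty E₁ := inferInstance
    have h1 : γ ^ n = 1 := eq_one_of_apply_eq (Γ.pow_mem hγ n) (x := j x) (by
      rw [← hpow, hαn]; rfl)
    have h2 := hΓ.torsionFree γ hγ (isOfFinOrder_iff_pow_eq_one.2 ⟨n, hn, h1⟩)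
    ext z
    refine j.injective ?_
    rw [h, h2]
    rfl

/-- The translations belonging to a lattice subspace act cocompactly on its cosets. -/
theorem IsLatticeSubspace.exists_isCompact [FiniteDimensional ℝ V₁] {L : AddSubgroup V}
    {V' : Submodule ℝ V} (hL : IsLatticeSubspace L V') (j : E₁ →ᵃⁱ[ℝ] E)
    (hj : range j.linearIsometry = (V' : Set V)) :
    ∃ K : Set E₁, IsCompact K ∧ ∀ x : E₁, ∃ l : V₁, j.linearIsometry l ∈ L ∧ l +ᵥ x ∈ K := by
  set s : Set V₁ := j.linearIsometry ⁻¹' L with hs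
  have hrange : LinearMap.range j.linearIsometry.toLinearMap = V' := SetLike.ext' hj
  have hspan : ⊤ ≤ Submodule.span ℝ s := by
    have h1 : (Submodule.span ℝ s).map j.linearIsometry.toLinearMap =
        (⊤ : Submodule ℝ V₁).map j.linearIsometry.toLinearMap := by
      rw [← Submodule.span_image, Submodule.map_top, hrange]
      have h2 : j.linearIsometry.toLinearMap '' s = (L : Set V) ∩ V' := by
        rw [← hj]
        exact image_preimage_eq_inter_range
      rw [h2]
      exact hL
    exact (Submodule.map_injective_of_injective j.linearIsometry.injective h1).ge
  -- The spanning set `s` contains a basis, whose integer combinations are all mapped into `L`.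
  -- Subtracting integer parts of coordinates moves any point into the fundamental parallelepiped.
  let b := Module.Basis.ofSpan hspan
  have hb : range b ⊆ s := Module.Basis.ofSpan_subset hspan
  have : Finite ((linearIndepOn_empty ℝ (id : V₁ → V₁)).extend (empty_subset s)) :=
    Module.Finite.finite_basis b
  have := Fintype.ofFinite ((linearIndepOn_empty ℝ (id : V₁ → V₁)).extend (empty_subset s))
  have : ProperSpace V₁ := FiniteDimensional.proper ℝ V₁
  obtain ⟨o⟩ : Nonempty E₁ := inferInstance
  refine ⟨(fun v ↦ v +ᵥ o) '' closure (ZSpan.fundamentalDomain b),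
    (ZSpan.fundamentalDomain_isBounded b).isCompact_closure.image
      (continuous_id.vadd continuous_const), fun x ↦ ⟨-(ZSpan.floor b (x -ᵥ o) : V₁), ?_, ?_⟩⟩
  · rw [map_neg]
    refine L.neg_mem ?_
    have h1 : (Submodule.span ℤ (range b)).toAddSubgroup ≤
        L.comap j.linearIsometry.toLinearMap.toAddMonoidHom := by
      rw [Submodule.span_int_eq_addSubgroupClosure, AddSubgroup.closure_le]
      exact hb
    exact h1 (ZSpan.floor b (x -ᵥ o)).2
  · refine ⟨ZSpan.fract b (x -ᵥ o), subset_closure (ZSpan.fract_mem_fundamentalDomain b _), ?_⟩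
    change (ZSpan.fract b (x -ᵥ o)) +ᵥ o = _
    rw [ZSpan.fract_apply, sub_eq_neg_add, add_vadd, vsub_vadd]

theorem vadd_restrict_mem {Γ : Subgroup (E ≃ᵃⁱ[ℝ] E)} (j : E₁ →ᵃⁱ[ℝ] E) {l : V₁}
    (hl : j.linearIsometry l ∈ latticeSubgroup Γ) :
    AffineIsometryEquiv.constVAdd ℝ E₁ l ∈ restrictSubgroup Γ j := by
  obtain ⟨γ, hγ, h⟩ := hl
  exact ⟨γ, hγ, fun x ↦ by rw [h, ← j.map_vadd]; rfl⟩

/-- Translations by `L ∩ V'` belong to the induced group, and already suffice for cocompactness. -/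
theorem isBieberbach_restrictSubgroup [FiniteDimensional ℝ V] [FiniteDimensional ℝ V₁]
    {Γ : Subgroup (E ≃ᵃⁱ[ℝ] E)} [IsDiscreteTorsionFree Γ] {V' : Submodule ℝ V}
    (hL : IsLatticeSubspace (latticeSubgroup Γ) V') (j : E₁ →ᵃⁱ[ℝ] E)
    (hj : range j.linearIsometry = (V' : Set V)) : IsBieberbach (restrictSubgroup Γ j) where
  exists_compact := by
    obtain ⟨K, hK, h⟩ := hL.exists_isCompact j hj
    refine ⟨K, hK, fun x ↦ ?_⟩
    obtain ⟨l, hl, hlx⟩ := h x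
    exact ⟨_, vadd_restrict_mem j hl, hlx⟩

theorem latticeSubgroup_translationSubgroup (Γ : Subgroup (E ≃ᵃⁱ[ℝ] E)) :
    latticeSubgroup (translationSubgroup Γ) = latticeSubgroup Γ := by
  ext v
  constructor
  · rintro ⟨γ, hγ, h⟩
    exact ⟨γ, hγ.1, h⟩
  · rintro ⟨γ, hγ, h⟩
    exact ⟨γ, ⟨hγ, v, h⟩, h⟩

end Restriction

end

/-! ### Parametrization of leaves by cosets -/

noncomputable section

section LocalDiffeomorphisms

variable {E₁ E₂ E₃ : Type*} [NormedAddCommGroup E₁] [NormedSpace ℝ E₁]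
  [NormedAddCommGroup E₂] [NormedSpace ℝ E₂] [NormedAddCommGroup E₃] [NormedSpace ℝ E₃]
  {M₁ M₂ M₃ : Type*} [TopologicalSpace M₁] [ChartedSpace E₁ M₁]
  [TopologicalSpace M₂] [ChartedSpace E₂ M₂] [TopologicalSpace M₃] [ChartedSpace E₃ M₃]

/-- The restriction of a partial diffeomorphism to an open subset of its source. -/
def PartialDiffeomorph.restrOpen (Φ : PartialDiffeomorph 𝓘(ℝ, E₁) 𝓘(ℝ, E₂) M₁ M₂ ∞) (s : Set M₁)
    (hs : IsOpen s) : PartialDiffeomorph 𝓘(ℝ, E₁) 𝓘(ℝ, E₂) M₁ M₂ ∞ where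
  __ := Φ.toOpenPartialHomeomorph.restrOpen s hs
  contMDiffOn_toFun := Φ.contMDiffOn_toFun.mono inter_subset_left
  contMDiffOn_invFun := Φ.contMDiffOn_invFun.mono inter_subset_left

theorem PartialDiffeomorph.isLocalDiffeomorphAt_of_eventuallyEq
    (Φ : PartialDiffeomorph 𝓘(ℝ, E₁) 𝓘(ℝ, E₂) M₁ M₂ ∞) {f : M₁ → M₂} {x : M₁} (hx : x ∈ Φ.source)
    (hf : f =ᶠ[𝓝 x] Φ) : IsLocalDiffeomorphAt 𝓘(ℝ, E₁) 𝓘(ℝ, E₂) ∞ f x := by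
  obtain ⟨s, hs, hso, hxs⟩ := mem_nhds_iff.1 hf
  exact ⟨Φ.restrOpen s hso, ⟨hx, hxs⟩, fun z hz ↦ hs hz.2⟩

/-- Locally, `g` is `g ∘ π` preceded by a local inverse of `π`. -/
theorem IsLocalDiffeomorph.of_comp {π : M₁ → M₂} (hπ : IsLocalDiffeomorph 𝓘(ℝ, E₁) 𝓘(ℝ, E₂) ∞ π)
    (hsurj : Function.Surjective π) {g : M₂ → M₃}
    (hg : IsLocalDiffeomorph 𝓘(ℝ, E₁) 𝓘(ℝ, E₃) ∞ (g ∘ π)) :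
    IsLocalDiffeomorph 𝓘(ℝ, E₂) 𝓘(ℝ, E₃) ∞ g := by
  intro y
  obtain ⟨x, rfl⟩ := hsurj y
  obtain ⟨Φ, hx, hΦ⟩ := hπ x
  obtain ⟨Ψ, hx', hΨ⟩ := hg x
  have hx2 : π x ∈ Φ.target := by
    rw [hΦ hx]
    exact Φ.map_source hx
  have hx3 : Φ.symm (π x) = x := by
    rw [hΦ hx]
    exact Φ.left_inv hx
  refine (Φ.symm.trans Ψ).isLocalDiffeomorphAt_of_eventuallyEq ⟨hx2, ?_⟩ ?_
  · change Φ.symm (π x) ∈ Ψ.source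
    rwa [hx3]
  · have hcont : ContinuousAt Φ.symm (π x) :=
      Φ.symm.contMDiffOn.continuousOn.continuousAt (Φ.open_target.mem_nhds hx2)
    filter_upwards [Φ.open_target.mem_nhds hx2,
      hcont.preimage_mem_nhds (Ψ.open_source.mem_nhds (by rwa [hx3]))] with z hz hz'
    change g z = Ψ (Φ.symm z)
    rw [← hΨ hz', Function.comp_apply, hΦ (Φ.symm.map_source hz)]
    exact congrArg g (Φ.right_inv hz).symm

theorem IsLocalDiffeomorph.contMDiff_of_comp {π : M₁ → M₂}
    (hπ : IsLocalDiffeomorph 𝓘(ℝ, E₁) 𝓘(ℝ, E₂) ∞ π)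
    (hsurj : Function.Surjective π) {g : M₂ → M₃}
    (hg : ContMDiff 𝓘(ℝ, E₁) 𝓘(ℝ, E₃) ∞ (g ∘ π)) : ContMDiff 𝓘(ℝ, E₂) 𝓘(ℝ, E₃) ∞ g := by
  intro y
  obtain ⟨x, rfl⟩ := hsurj y
  have h1 := (hπ x).localInverse_contMDiffAt
  refine (hg.contMDiffAt.comp _ h1).congr_of_eventuallyEq ?_
  filter_upwards [(hπ x).localInverse_eventuallyEq_right] with z hz
  exact congrArg g hz.symm

end LocalDiffeomorphisms

universe u

variable {V : Type*} {E : Type u} [NormedAddCommGroup V] [InnerProductSpace ℝ V]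
  [MetricSpace E] [NormedAddTorsor V E]
  {N : Type u} [TopologicalSpace N] [ChartedSpace V N] [IsManifold 𝓘(ℝ, V) ∞ N]
  {V₁ E₁ : Type*} [NormedAddCommGroup V₁] [InnerProductSpace ℝ V₁]
  [MetricSpace E₁] [NormedAddTorsor V₁ E₁]

theorem IsFlatCover.isLocalDiffeomorph {Γ : Subgroup (E ≃ᵃⁱ[ℝ] E)} {V' : Submodule ℝ V} {ψ : E → N}
    (h : IsFlatCover Γ V' ψ) : IsLocalDiffeomorph 𝓘(ℝ, V) 𝓘(ℝ, V) ∞ ψ := by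
  intro x
  obtain ⟨A, b, -, hA⟩ := h.exists_coord _ (chart_mem_atlas V (ψ x)) x (mem_chart_source V _)
  set e := chartAt V (ψ x)
  -- This origin absorbs `b`, so that in the chart `ψ` becomes the linear mapping `A` applied to `z
  -- -ᵥ o`.
  set o := (affineChart V E).symm (-A.symm b) with ho
  have hcoord : ∀ z : E, A (affineChart V E z) + b = A (z -ᵥ o) := by
    intro z
    rw [← affineChart_sub, ho, Homeomorph.apply_symm_apply]
    simp
  have hex : A (x -ᵥ o) = e (ψ x) := by rw [hA.self_of_nhds.2, hcoord]
  let Ψ₁ : PartialDiffeomorph 𝓘(ℝ, V) 𝓘(ℝ, V) V V ∞ :=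
    (A.toContinuousLinearEquiv.toDiffeomorph).toPartialDiffeomorph
  let Ψ₂ : PartialDiffeomorph 𝓘(ℝ, V) 𝓘(ℝ, V) V N ∞ :=
    { toPartialEquiv := e.symm.toPartialEquiv
      open_source := e.open_target
      open_target := e.open_source
      contMDiffOn_toFun := contMDiffOn_chart_symm
      contMDiffOn_invFun := contMDiffOn_chart }
  refine (((vsubDiffeomorph o).toPartialDiffeomorph.trans Ψ₁).trans
    Ψ₂).isLocalDiffeomorphAt_of_eventuallyEq ⟨⟨mem_univ _, mem_univ _⟩, ?_⟩ ?_
  · change A (x -ᵥ o) ∈ e.target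
    rw [hex]
    exact e.map_source (mem_chart_source V _)
  · filter_upwards [hA] with z hz
    change ψ z = e.symm (A (z -ᵥ o))
    rw [← hcoord, ← hz.2, e.left_inv hz.1]

theorem isLocalDiffeomorph_quotientProj [FiniteDimensional ℝ V] (Γ : Subgroup (E ≃ᵃⁱ[ℝ] E))
    [IsDiscreteTorsionFree Γ] :
    IsLocalDiffeomorph 𝓘(ℝ, V) 𝓘(ℝ, V) ∞ (quotientProj Γ) :=
  (isFlatCover_quotientProj Γ ⊤ fun _ _ _ ↦ by simp).isLocalDiffeomorph

theorem quotientProj_surjective (Γ : Subgroup (E ≃ᵃⁱ[ℝ] E)) :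
    Function.Surjective (quotientProj Γ) := Quotient.mk_surjective

theorem AffineIsometry.mem_range_iff {V E : Type*} [NormedAddCommGroup V] [InnerProductSpace ℝ V]
    [MetricSpace E] [NormedAddTorsor V E] {V' : Submodule ℝ V} {j : E₁ →ᵃⁱ[ℝ] E}
    (hj : range j.linearIsometry = (V' : Set V)) (x : E₁) {y : E} :
    y ∈ range j ↔ y -ᵥ j x ∈ V' := by
  constructor
  · rintro ⟨z, rfl⟩
    rw [← j.map_vsub]
    exact hj.subset (mem_range_self _)
  · intro hy
    obtain ⟨v, hv⟩ := hj.superset hy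
    exact ⟨v +ᵥ x, by rw [j.map_vadd, hv, vsub_vadd]⟩

namespace IsFlatCover

variable {Γ : Subgroup (E ≃ᵃⁱ[ℝ] E)} {V' : Submodule ℝ V} {ψ : E → N}

-- An element of `Γ` taking one point of the coset to another preserves the whole coset, as its
-- linear part preserves `V'`; it therefore restricts to the coset.
omit [IsManifold 𝓘(ℝ, V) ∞ N] in
theorem quotientProj_restrict_eq_iff [FiniteDimensional ℝ V₁] (h : IsFlatCover Γ V' ψ)
    (j : E₁ →ᵃⁱ[ℝ] E) (hj : range j.linearIsometry = (V' : Set V)) {x y : E₁} :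
    quotientProj (restrictSubgroup Γ j) x = quotientProj (restrictSubgroup Γ j) y ↔
      ψ (j x) = ψ (j y) := by
  rw [quotientProj_eq_iff, h.eq_iff]
  constructor
  · rintro ⟨γ', ⟨γ, hγ, hγγ⟩, rfl⟩
    exact ⟨γ, hγ, (hγγ x).symm⟩
  · rintro ⟨γ, hγ, hxy⟩
    obtain ⟨γ', hγ'⟩ := exists_restrict hj (fun v hv ↦ (h.linear_mem_iff γ hγ v).2 hv) hxy
    exact ⟨γ', ⟨γ, hγ, hγ'⟩, j.injective (by rw [hγ', hxy])⟩

variable [FiniteDimensional ℝ V]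

section Leaves

variable [FiniteDimensional ℝ V₁] (h : IsFlatCover Γ V' ψ) {S : ImmersedSubmanifold V N}
  (hS : h.distribution.IsIntegralManifold S) (j : E₁ →ᵃⁱ[ℝ] E)
  (hj : range j.linearIsometry = (V' : Set V))

include hS hj

/-- After a translation making `j` pass through `y`, the local parametrization by the coset of `y`
covers a neighborhood of `p`. -/
theorem exists_isOpen_lift {p : S.Pt} {y : E} (hp : S.incl p = ψ y) :
    ∃ W : Set S.Pt, IsOpen W ∧ p ∈ W ∧ ∀ q ∈ W, ∃ z, z -ᵥ y ∈ V' ∧ S.incl q = ψ z := by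
  obtain ⟨x⟩ : Nonempty E₁ := inferInstance
  let j' : E₁ →ᵃⁱ[ℝ] E := (AffineIsometryEquiv.constVAdd ℝ E (y -ᵥ j x)).toAffineIsometry.comp j
  have hj' : range j'.linearIsometry = (V' : Set V) := hj
  have hx : j' x = y := vsub_vadd _ _
  obtain ⟨Φ, hxΦ, hΦ, hΦψ⟩ := h.exists_partialDiffeomorph hS j' hj' (x := x) (p := p) (by rw [hx, hp])
  refine ⟨Φ.target, Φ.open_target, hΦ ▸ Φ.map_source hxΦ, fun q hq ↦ ⟨j' (Φ.symm q), ?_, ?_⟩⟩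
  · rw [← hx]
    exact (AffineIsometry.mem_range_iff hj' x).1 ⟨_, rfl⟩
  · rw [← hΦψ _ (Φ.symm.map_source hq)]
    exact congrArg S.incl (Φ.right_inv hq).symm

/-- A connected integral manifold lies over a single coset of `V'`. -/
theorem range_incl_subset [ConnectedSpace S.Pt] {p₀ : S.Pt} {x₀ : E₁}
    (hp : S.incl p₀ = ψ (j x₀)) : range S.incl ⊆ range (ψ ∘ j) := by
  have hclopen : IsClopen {p | ∃ y ∈ range j, S.incl p = ψ y} := by
    constructor
    · rw [← isOpen_compl_iff, isOpen_iff_mem_nhds]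
      intro p hps
      obtain ⟨y, hy⟩ := h.surjective (S.incl p)
      obtain ⟨W, hW, hpW, hWy⟩ := h.exists_isOpen_lift hS j hj hy.symm
      refine mem_of_superset (hW.mem_nhds hpW) ?_
      -- If `q` near `p` lies over the image of `j`, some `γ` takes a point `y'` of the coset of `y`
      -- into that image. Since the linear part of `γ` preserves `V'`, `γ y` lies there too, and
      -- then so does a lift of `p`.
      rintro q hq ⟨z, hz, hqz⟩
      obtain ⟨y', hy', hqy'⟩ := hWy q hq
      obtain ⟨γ, hγ, hγz⟩ := h.eq_iff.1 (hqy'.symm.trans hqz)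
      refine hps ⟨γ y, (AffineIsometry.mem_range_iff hj x₀).2 ?_, ?_⟩
      · rw [← vsub_add_vsub_cancel (γ y) (γ y') (j x₀), hγz]
        refine V'.add_mem ?_ ((AffineIsometry.mem_range_iff hj x₀).1 hz)
        rw [← hγz, ← γ.map_vsub, h.linear_mem_iff γ hγ, ← neg_vsub_eq_vsub_rev]
        exact V'.neg_mem hy'
      · rw [← hy]
        exact h.eq_iff.2 ⟨γ, hγ, rfl⟩
    · rw [isOpen_iff_mem_nhds]
      rintro p ⟨y, hy, hpy⟩
      obtain ⟨W, hW, hpW, hWy⟩ := h.exists_isOpen_lift hS j hj hpy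
      refine mem_of_superset (hW.mem_nhds hpW) fun q hq ↦ ?_
      obtain ⟨z, hz, hqz⟩ := hWy q hq
      refine ⟨z, (AffineIsometry.mem_range_iff hj x₀).2 ?_, hqz⟩
      rw [← vsub_add_vsub_cancel z y (j x₀)]
      exact V'.add_mem hz ((AffineIsometry.mem_range_iff hj x₀).1 hy)
  have huniv := hclopen.eq_univ ⟨p₀, j x₀, mem_range_self _, hp⟩
  rintro _ ⟨p, rfl⟩
  obtain ⟨_, ⟨x, rfl⟩, hpx⟩ := huniv.superset (mem_univ p)
  exact ⟨x, hpx.symm⟩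

variable {f : E₁ → S.Pt} (hf : ∀ x, S.incl (f x) = ψ (j x))

include hf

/-- Continuity of `f` is not presupposed: as `S.incl` is injective, `f` must agree with the local
parametrization near each point. -/
theorem isLocalDiffeomorph_param : IsLocalDiffeomorph 𝓘(ℝ, V₁) S.model ∞ f := by
  intro x
  obtain ⟨Φ, hx, -, hΦ⟩ := h.exists_partialDiffeomorph hS j hj (hf x)
  exact ⟨Φ, hx, fun z hz ↦ S.incl_injective ((hf z).trans (hΦ z hz).symm)⟩

/-- An integral manifold parametrized by a coset of `V'` is its quotient by a group of isometries. -/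
theorem exists_diffeomorph [IsDiscreteTorsionFree Γ] (hsurj : Function.Surjective f) :
    ∃ Φ : Diffeomorph 𝓘(ℝ, V₁) S.model (FlatQuotient (restrictSubgroup Γ j)) S.Pt ∞,
      ∀ x, Φ (quotientProj (restrictSubgroup Γ j) x) = f x := by
  have hiff : ∀ {x y}, quotientProj (restrictSubgroup Γ j) x = quotientProj (restrictSubgroup Γ j) y ↔
      f x = f y := by
    intro x y
    rw [h.quotientProj_restrict_eq_iff j hj, ← hf, ← hf, S.incl_injective.eq_iff]
  let φ : FlatQuotient (restrictSubgroup Γ j) → S.Pt := Quotient.lift f fun x y hxy ↦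
    hiff.1 (Quotient.sound (s := MulAction.orbitRel (restrictSubgroup Γ j) E₁) hxy)
  have hφ : IsLocalDiffeomorph 𝓘(ℝ, V₁) S.model ∞ φ :=
    (isLocalDiffeomorph_quotientProj (restrictSubgroup Γ j)).of_comp (quotientProj_surjective _)
      (h.isLocalDiffeomorph_param hS j hj hf)
  have hbij : Function.Bijective φ := by
    constructor
    · intro a b hab
      obtain ⟨x, rfl⟩ := quotientProj_surjective _ a
      obtain ⟨y, rfl⟩ := quotientProj_surjective _ b
      exact hiff.2 hab
    · intro p
      obtain ⟨x, rfl⟩ := hsurj p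
      exact ⟨quotientProj _ x, rfl⟩
  refine ⟨hφ.diffeomorphOfBijective hbij, fun x ↦ rfl⟩

theorem isSmoothCovering_param [IsDiscreteTorsionFree Γ] (hsurj : Function.Surjective f) :
    IsSmoothCovering (F := EuclideanSpace ℝ (Fin S.dim)) (F' := V₁) f := by
  refine ⟨hsurj, ?_, h.isLocalDiffeomorph_param hS j hj hf⟩
  obtain ⟨Φ, hΦ⟩ := h.exists_diffeomorph hS j hj hf hsurj
  have h1 : IsQuotientCoveringMap (quotientProj (restrictSubgroup Γ j)) (restrictSubgroup Γ j) :=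
    isQuotientCoveringMap_quotientMk_of_properlyDiscontinuousSMul
  have h2 := (h1.homeomorph_comp Φ.toHomeomorph).isCoveringMap
  rwa [show Φ.toHomeomorph ∘ quotientProj (restrictSubgroup Γ j) = f from funext hΦ] at h2

/-- The differential of the parametrization of a leaf is isometric. -/
theorem inducedInner_param (g : SmoothMetric V N)
    (hg : ∀ (m : N) (a b : V), g.inner m a b = inner ℝ a b) (x : E₁) (a b : V₁) :
    S.inducedInner g (f x) (mfderiv 𝓘(ℝ, V₁) S.model f x a) (mfderiv 𝓘(ℝ, V₁) S.model f x b) =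
      inner ℝ a b := by
  obtain ⟨A, -, hA⟩ := h.exists_hasMFDerivAt (j x) h.isLocalDiffeomorph.contMDiff.continuous.continuousAt
  have h1 : HasMFDerivAt 𝓘(ℝ, V₁) 𝓘(ℝ, V) (ψ ∘ j) x
    ((A : V →L[ℝ] V).comp j.linearIsometry.toContinuousLinearMap) := hA.comp x (j.hasMFDerivAt x)
  have h2 : mfderiv 𝓘(ℝ, V₁) 𝓘(ℝ, V) (S.incl ∘ f) x =
      (S.dIncl (f x)).comp (mfderiv 𝓘(ℝ, V₁) S.model f x) :=
    mfderiv_comp x ((S.contMDiff_incl _).mdifferentiableAt (by simp))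
      (((h.isLocalDiffeomorph_param hS j hj hf) x).mdifferentiableAt (by simp))
  have h3 : ∀ v : V₁, (S.dIncl (f x) (mfderiv 𝓘(ℝ, V₁) S.model f x v) : V) =
      A (j.linearIsometry v) := by
    intro v
    rw [← show S.incl ∘ f = ψ ∘ j from funext hf] at h1
    have h4 := h1.mfderiv
    rw [h2] at h4
    exact congrArg (fun T : V₁ →L[ℝ] V ↦ T v) h4
  refine (hg _ _ _).trans ?_
  exact (congrArg₂ (fun v w : V ↦ (inner ℝ v w : ℝ)) (h3 a) (h3 b)).trans
    (by rw [A.inner_map_map, j.linearIsometry.inner_map_map])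

/-- Lattice translations do not change `ψ`, so `f` maps a compact set meeting all their orbits in
`E₁` onto `S`. -/
theorem compactSpace_of_param (hL : IsLatticeSubspace (latticeSubgroup Γ) V')
    (hsurj : Function.Surjective f) : CompactSpace S.Pt := by
  obtain ⟨K, hK, hKx⟩ := hL.exists_isCompact j hj
  refine ⟨?_⟩
  convert hK.image (h.isLocalDiffeomorph_param hS j hj hf).contMDiff.continuous
  refine (eq_univ_of_forall fun p ↦ ?_).symm
  obtain ⟨x, rfl⟩ := hsurj p
  obtain ⟨l, ⟨γ, hγ, hγl⟩, hl⟩ := hKx x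
  refine ⟨l +ᵥ x, hl, S.incl_injective ?_⟩
  rw [hf, hf, j.map_vadd, ← hγl]
  exact (h.eq_iff.2 ⟨γ, hγ, rfl⟩).symm

/-- The inverse of the parametrization of a leaf is a flat chart. -/
theorem isFlat_of_param (g : SmoothMetric V N)
    (hg : ∀ (m : N) (a b : V), g.inner m a b = inner ℝ a b)
    (hsurj : Function.Surjective f) : S.IsFlat g := by
  intro p
  obtain ⟨x, rfl⟩ := hsurj p
  have hloc := h.isLocalDiffeomorph_param hS j hj hf
  have hbij : ∀ z, Function.Bijective (mfderiv 𝓘(ℝ, V₁) S.model f z) := fun z ↦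
    ((hloc z).mfderivToContinuousLinearEquiv (by simp)).bijective
  -- The differential of `f` is bijective, which determines the dimension of `S`.
  have hdim : Module.finrank ℝ V₁ = S.dim := by
    have h1 : Module.finrank ℝ V₁ = Module.finrank ℝ (EuclideanSpace ℝ (Fin S.dim)) :=
      ((hloc x).mfderivToContinuousLinearEquiv (by simp)).toLinearEquiv.finrank_eq
    rw [h1, finrank_euclideanSpace_fin]
  let i : V₁ ≃ₗᵢ[ℝ] EuclideanSpace ℝ (Fin S.dim) :=
    ((stdOrthonormalBasis ℝ V₁).reindex (finCongr hdim)).repr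
  obtain ⟨Φ, hx, hΦ⟩ := hloc x
  let Ψ : PartialDiffeomorph 𝓘(ℝ, V₁) S.model V₁ (EuclideanSpace ℝ (Fin S.dim)) ∞ :=
    i.toContinuousLinearEquiv.toDiffeomorph.toPartialDiffeomorph
  let Θ := (Φ.symm.trans (vsubDiffeomorph x).toPartialDiffeomorph).trans Ψ
  refine ⟨Θ.toOpenPartialHomeomorph,
    (IsManifold.mem_maximalAtlas_iff_contMDiffOn _).2 ⟨Θ.contMDiffOn_toFun, Θ.contMDiffOn_invFun⟩,
    ⟨⟨?_, mem_univ _⟩, mem_univ _⟩, ?_⟩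
  · rw [hΦ hx]
    exact Φ.map_source hx
  · rintro q ⟨⟨hq : q ∈ Φ.target, -⟩, -⟩
    obtain ⟨z, hz, rfl⟩ : ∃ z ∈ Φ.source, f z = q :=
      ⟨Φ.symm q, Φ.symm.map_source hq, (hΦ (Φ.symm.map_source hq)).trans (Φ.right_inv hq)⟩
    -- The chart `Θ` undoes `f` up to the linear isometry `i`, so its differential inverts that of
    -- `f`, which is isometric.
    have hev : Θ.toOpenPartialHomeomorph ∘ f =ᶠ[𝓝 z] i ∘ vsubDiffeomorph x := by
      filter_upwards [Φ.open_source.mem_nhds hz] with w hw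
      change i (Φ.symm (f w) -ᵥ x) = i (w -ᵥ x)
      rw [hΦ hw]
      exact congrArg (fun y ↦ i (y -ᵥ x)) (Φ.left_inv hw)
    have h1 : HasMFDerivAt 𝓘(ℝ, V₁) S.model (i ∘ vsubDiffeomorph x) z
        ((i : V₁ →L[ℝ] EuclideanSpace ℝ (Fin S.dim)).comp (ContinuousLinearMap.id ℝ V₁)) :=
      (i : V₁ →L[ℝ] EuclideanSpace ℝ (Fin S.dim)).hasMFDerivAt.comp z
        (vsubDiffeomorph_hasMFDerivAt x z)
    have hfz : f z ∈ Θ.source := ⟨⟨hq, mem_univ _⟩, mem_univ _⟩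
    have h2 : mfderiv 𝓘(ℝ, V₁) S.model (Θ.toOpenPartialHomeomorph ∘ f) z =
        (mfderiv S.model S.model Θ.toOpenPartialHomeomorph (f z)).comp
          (mfderiv 𝓘(ℝ, V₁) S.model f z) :=
      mfderiv_comp z (Θ.mdifferentiableAt (by simp) hfz) ((hloc z).mdifferentiableAt (by simp))
    have h3 : ∀ v : V₁, (mfderiv S.model S.model Θ.toOpenPartialHomeomorph (f z)
        (mfderiv 𝓘(ℝ, V₁) S.model f z v) : EuclideanSpace ℝ (Fin S.dim)) = i v := by
      intro v
      have h4 := hev.mfderiv_eq.trans h1.mfderiv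
      rw [h2] at h4
      exact congrArg (fun T : V₁ →L[ℝ] EuclideanSpace ℝ (Fin S.dim) ↦ T v) h4
    intro a b
    obtain ⟨a, rfl⟩ := (hbij z).2 a
    obtain ⟨b, rfl⟩ := (hbij z).2 b
    refine (h.inducedInner_param hS j hj hf g hg z a b).trans ?_
    exact (i.inner_map_map a b).symm.trans
      (congrArg₂ (fun v w : EuclideanSpace ℝ (Fin S.dim) ↦ (inner ℝ v w : ℝ)) (h3 a) (h3 b)).symm

end Leaves

end IsFlatCover

end

/-! ### Construction and classification of leaves -/

noncomputable section

universe u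

section ChangeOfModel

variable {V₁ V₂ : Type*} [NormedAddCommGroup V₁] [InnerProductSpace ℝ V₁]
  [NormedAddCommGroup V₂] [InnerProductSpace ℝ V₂]

/-- A Euclidean affine space, with its translation space replaced by an isometric one. -/
def ModelCopy (_i : V₂ ≃ₗᵢ[ℝ] V₁) (E₁ : Type u) : Type u := E₁

variable (i : V₂ ≃ₗᵢ[ℝ] V₁) (E₁ : Type u) [MetricSpace E₁] [NormedAddTorsor V₁ E₁]

instance : MetricSpace (ModelCopy i E₁) := inferInstanceAs (MetricSpace E₁)

/-- The identity of the underlying set. -/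
def ModelCopy.equiv : ModelCopy i E₁ ≃ E₁ := Equiv.refl E₁

instance : NormedAddTorsor V₂ (ModelCopy i E₁) where
  vadd v x := (ModelCopy.equiv i E₁).symm (i v +ᵥ ModelCopy.equiv i E₁ x)
  zero_vadd x := by
    change i 0 +ᵥ ModelCopy.equiv i E₁ x = ModelCopy.equiv i E₁ x
    rw [map_zero, zero_vadd]
  add_vadd v w x := by
    change i (v + w) +ᵥ ModelCopy.equiv i E₁ x = i v +ᵥ (i w +ᵥ ModelCopy.equiv i E₁ x)
    rw [map_add, add_vadd]
  vsub x y := i.symm (ModelCopy.equiv i E₁ x -ᵥ ModelCopy.equiv i E₁ y)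
  nonempty := (ModelCopy.equiv i E₁).nonempty
  vsub_vadd' x y := by
    change i (i.symm (ModelCopy.equiv i E₁ x -ᵥ ModelCopy.equiv i E₁ y)) +ᵥ
      ModelCopy.equiv i E₁ y = ModelCopy.equiv i E₁ x
    rw [i.apply_symm_apply, vsub_vadd]
  vadd_vsub' v x := by
    change i.symm ((i v +ᵥ ModelCopy.equiv i E₁ x) -ᵥ ModelCopy.equiv i E₁ x) = v
    rw [vadd_vsub, i.symm_apply_apply]
  dist_eq_norm' x y := by
    change dist (ModelCopy.equiv i E₁ x) (ModelCopy.equiv i E₁ y) =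
      ‖i.symm (ModelCopy.equiv i E₁ x -ᵥ ModelCopy.equiv i E₁ y)‖
    rw [i.symm.norm_map, dist_eq_norm_vsub V₁]

/-- The identity of the underlying set, as an affine isometry. -/
def ModelCopy.affineIsometry : ModelCopy i E₁ →ᵃⁱ[ℝ] E₁ where
  toFun := ModelCopy.equiv i E₁
  linear := i.toLinearEquiv.toLinearMap
  map_vadd' _ _ := rfl
  norm_map v := i.norm_map v

end ChangeOfModel

variable {V : Type*} {E : Type u} [NormedAddCommGroup V] [InnerProductSpace ℝ V]
  [FiniteDimensional ℝ V] [MetricSpace E] [NormedAddTorsor V E]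
  {N : Type u} [TopologicalSpace N] [ChartedSpace V N] [IsManifold 𝓘(ℝ, V) ∞ N]

namespace IsFlatCover

variable {Γ : Subgroup (E ≃ᵃⁱ[ℝ] E)} {V' : Submodule ℝ V} {ψ : E → N}

section ModelLeaf

variable (h : IsFlatCover Γ V' ψ) {n : ℕ} {E₁ : Type u} [MetricSpace E₁]
  [NormedAddTorsor (EuclideanSpace ℝ (Fin n)) E₁] (j : E₁ →ᵃⁱ[ℝ] E)
  (hj : range j.linearIsometry = (V' : Set V))

/-- The mapping `E₁ / Γ₁ → N` induced by `ψ ∘ j`, where `Γ₁` is the group induced on `E₁` by `Γ`. -/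
def quotientLift : FlatQuotient (restrictSubgroup Γ j) → N :=
  Quotient.lift (ψ ∘ j) fun _ _ hxy ↦ (h.quotientProj_restrict_eq_iff j hj).1
    (Quotient.sound (s := MulAction.orbitRel (restrictSubgroup Γ j) E₁) hxy)

variable [IsDiscreteTorsionFree Γ]

theorem contMDiff_quotientLift :
    ContMDiff 𝓘(ℝ, EuclideanSpace ℝ (Fin n)) 𝓘(ℝ, V) ∞ (h.quotientLift j hj) :=
  (isLocalDiffeomorph_quotientProj (restrictSubgroup Γ j)).contMDiff_of_comp
    (quotientProj_surjective _) (h.isLocalDiffeomorph.contMDiff.comp j.contMDiff)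

theorem exists_mfderiv_quotientLift (x : E₁) : ∃ A : V ≃ₗᵢ[ℝ] V, (∀ v, A v ∈ V' ↔ v ∈ V') ∧
    ∀ v : EuclideanSpace ℝ (Fin n), mfderiv 𝓘(ℝ, EuclideanSpace ℝ (Fin n)) 𝓘(ℝ, V)
      (h.quotientLift j hj) (quotientProj (restrictSubgroup Γ j) x)
      (mfderiv 𝓘(ℝ, EuclideanSpace ℝ (Fin n)) 𝓘(ℝ, EuclideanSpace ℝ (Fin n))
        (quotientProj (restrictSubgroup Γ j)) x v) = A (j.linearIsometry v) := by
  obtain ⟨A, hAV, hA⟩ :=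
    h.exists_hasMFDerivAt (j x) h.isLocalDiffeomorph.contMDiff.continuous.continuousAt
  refine ⟨A, hAV, fun v ↦ ?_⟩
  have h1 : HasMFDerivAt 𝓘(ℝ, EuclideanSpace ℝ (Fin n)) 𝓘(ℝ, V) (ψ ∘ j) x
    ((A : V →L[ℝ] V).comp j.linearIsometry.toContinuousLinearMap) := hA.comp x (j.hasMFDerivAt x)
  have h2 := mfderiv_comp x (((h.contMDiff_quotientLift j hj) _).mdifferentiableAt (by simp))
    (((isLocalDiffeomorph_quotientProj (restrictSubgroup Γ j)) x).mdifferentiableAt (by simp))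
  have h3 := h2.symm.trans h1.mfderiv
  exact congrArg (fun T : EuclideanSpace ℝ (Fin n) →L[ℝ] V ↦ T v) h3

theorem mfderiv_quotientProj_surjective (x : E₁) : Function.Surjective
    (mfderiv 𝓘(ℝ, EuclideanSpace ℝ (Fin n)) 𝓘(ℝ, EuclideanSpace ℝ (Fin n))
        (quotientProj (restrictSubgroup Γ j)) x) :=
  (((isLocalDiffeomorph_quotientProj (restrictSubgroup Γ j)) x).mfderivToContinuousLinearEquiv
    (by simp)).surjective

/-- The image in `N` of a coset of `V'`, as a submanifold. -/
def modelLeaf : ImmersedSubmanifold V N where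
  Pt := FlatQuotient (restrictSubgroup Γ j)
  t2Pt := t2Space_of_properlyDiscontinuousSMul_of_t2Space
  secondCountablePt := ContinuousConstSMul.secondCountableTopology
  dim := n
  incl := h.quotientLift j hj
  incl_injective := by
    intro a b hab
    obtain ⟨x, rfl⟩ := quotientProj_surjective _ a
    obtain ⟨y, rfl⟩ := quotientProj_surjective _ b
    exact (h.quotientProj_restrict_eq_iff j hj).2 hab
  contMDiff_incl := h.contMDiff_quotientLift j hj
  mfderiv_incl_injective := by
    intro p
    obtain ⟨x, rfl⟩ := quotientProj_surjective _ p
    obtain ⟨A, -, hA⟩ := h.exists_mfderiv_quotientLift j hj x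
    intro a b hab
    obtain ⟨a, rfl⟩ := mfderiv_quotientProj_surjective j x a
    obtain ⟨b, rfl⟩ := mfderiv_quotientProj_surjective j x b
    have := (hA a).symm.trans (hab.trans (hA b))
    rw [j.linearIsometry.injective (A.injective this)]

theorem isIntegralManifold_modelLeaf : h.distribution.IsIntegralManifold (h.modelLeaf j hj) := by
  intro p
  obtain ⟨x, rfl⟩ := quotientProj_surjective _ p
  obtain ⟨A, hAV, hA⟩ := h.exists_mfderiv_quotientLift j hj x
  have hiff : ∀ w : V, w ∈ (h.modelLeaf j hj).tangent (quotientProj (restrictSubgroup Γ j) x) ↔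
      w ∈ V' := by
    intro w
    constructor
    · rintro ⟨a, rfl⟩
      obtain ⟨a, rfl⟩ := mfderiv_quotientProj_surjective j x a
      have h1 : A (j.linearIsometry a) ∈ V' := (hAV _).2 (hj.subset (mem_range_self a))
      exact (hA a) ▸ h1
    · intro hw
      obtain ⟨a, ha⟩ := hj.superset ((hAV (A.symm w)).1 (by simpa using hw))
      exact ⟨_, (hA a).trans ((congrArg A ha).trans (A.apply_symm_apply w))⟩
  exact SetLike.ext hiff

theorem range_modelLeaf : range (h.modelLeaf j hj).incl = range (ψ ∘ j) := by
  ext m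
  constructor
  · rintro ⟨p, rfl⟩
    obtain ⟨x, rfl⟩ := quotientProj_surjective _ p
    exact ⟨x, rfl⟩
  · rintro ⟨x, rfl⟩
    exact ⟨quotientProj _ x, rfl⟩

theorem connectedSpace_modelLeaf : ConnectedSpace (h.modelLeaf j hj).Pt := by
  have h1 : ConnectedSpace E₁ :=
    (affineChart (EuclideanSpace ℝ (Fin n)) E₁).symm.surjective.connectedSpace
      (affineChart (EuclideanSpace ℝ (Fin n)) E₁).symm.continuous
  exact (quotientProj_surjective (restrictSubgroup Γ j)).connectedSpace (continuous_quotientProj _)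

end ModelLeaf

variable [IsDiscreteTorsionFree Γ] (h : IsFlatCover Γ V' ψ)

omit [FiniteDimensional ℝ V] in
theorem range_subtypeₐᵢ_linear {E' : AffineSubspace ℝ E} [Nonempty E'] (hE' : E'.direction = V') :
    range E'.subtypeₐᵢ.linearIsometry = (V' : Set V) := by
  subst hE'
  exact Subtype.range_coe

omit [FiniteDimensional ℝ V] [TopologicalSpace N] [ChartedSpace V N] [IsManifold 𝓘(ℝ, V) ∞ N] in
theorem range_comp_subtypeₐᵢ (ψ : E → N) (E' : AffineSubspace ℝ E) [Nonempty E'] :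
    range (ψ ∘ E'.subtypeₐᵢ) = ψ '' E' := by
  rw [range_comp]
  congr 1
  exact Subtype.range_coe

theorem exists_connected_integralManifold (E' : AffineSubspace ℝ E) [Nonempty E']
    (hE' : E'.direction = V') :
    ∃ S : ImmersedSubmanifold V N, ConnectedSpace S.Pt ∧ h.distribution.IsIntegralManifold S ∧
      range S.incl = ψ '' E' := by
  -- Submanifolds are modelled on standard Euclidean spaces, so an orthonormal basis replaces the
  -- translation space of `E'`, leaving its points unchanged.
  let i := (stdOrthonormalBasis ℝ E'.direction).repr.symm
  let j : ModelCopy i E' →ᵃⁱ[ℝ] E := E'.subtypeₐᵢ.comp (ModelCopy.affineIsometry i E')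
  have hj : range j.linearIsometry = (V' : Set V) := by
    rw [← range_subtypeₐᵢ_linear hE']
    exact i.surjective.range_comp E'.subtypeₐᵢ.linearIsometry
  refine ⟨h.modelLeaf j hj, h.connectedSpace_modelLeaf j hj, h.isIntegralManifold_modelLeaf j hj, ?_⟩
  rw [range_modelLeaf, ← range_comp_subtypeₐᵢ ψ E']
  exact (ModelCopy.equiv i E').surjective.range_comp (ψ ∘ E'.subtypeₐᵢ)

theorem isIntegrable : h.distribution.IsIntegrable := by
  intro m
  obtain ⟨x, rfl⟩ := h.surjective m
  have : Nonempty (AffineSubspace.mk' x V') := ⟨x, AffineSubspace.self_mem_mk' x V'⟩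
  obtain ⟨S, -, hS, hr⟩ := h.exists_connected_integralManifold (AffineSubspace.mk' x V')
    (AffineSubspace.direction_mk' x V')
  exact ⟨S, hS, hr ▸ ⟨x, AffineSubspace.self_mem_mk' x V', rfl⟩⟩

omit [IsDiscreteTorsionFree Γ] in
theorem range_subset_image {S : ImmersedSubmanifold V N} [ConnectedSpace S.Pt]
    (hS : h.distribution.IsIntegralManifold S) {E' : AffineSubspace ℝ E}
    (hE' : E'.direction = V') {x : E} (hx : x ∈ E') (hxS : ψ x ∈ range S.incl) :
    range S.incl ⊆ ψ '' E' := by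
  have : Nonempty E' := ⟨x, hx⟩
  obtain ⟨p, hp⟩ := hxS
  rw [← range_comp_subtypeₐᵢ ψ E']
  exact h.range_incl_subset hS E'.subtypeₐᵢ (range_subtypeₐᵢ_linear hE') (x₀ := ⟨x, hx⟩) hp

/-- The coset through a point over `S` carries a connected integral manifold whose image contains
that of `S`; maximality gives equality. -/
theorem exists_range_eq_of_isLeaf {S : ImmersedSubmanifold V N} (hS : h.distribution.IsLeaf S) :
    ∃ E' : AffineSubspace ℝ E, (E' : Set E).Nonempty ∧ E'.direction = V' ∧
      range S.incl = ψ '' E' := by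
  obtain ⟨hc, hSi, hmax⟩ := hS
  obtain ⟨p⟩ : Nonempty S.Pt := inferInstance
  obtain ⟨x, hx⟩ := h.surjective (S.incl p)
  have hxE := AffineSubspace.self_mem_mk' x V'
  have : Nonempty (AffineSubspace.mk' x V') := ⟨x, hxE⟩
  have hd := AffineSubspace.direction_mk' x V'
  refine ⟨AffineSubspace.mk' x V', ⟨x, hxE⟩, hd, ?_⟩
  obtain ⟨S', hc', hS', hr⟩ := h.exists_connected_integralManifold (AffineSubspace.mk' x V') hd
  rw [← hr]
  refine (hmax S' hc' hS' ?_).symm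
  rw [hr]
  exact h.range_subset_image hSi hd hxE (hx ▸ mem_range_self p)

-- A connected integral manifold whose image contains `ψ '' E'` itself lies over `E'`, and so has no
-- further points.
omit [IsDiscreteTorsionFree Γ] in
theorem isLeaf_of_range_eq {S : ImmersedSubmanifold V N} [ConnectedSpace S.Pt]
    (hS : h.distribution.IsIntegralManifold S) {E' : AffineSubspace ℝ E} [hne : Nonempty E']
    (hE' : E'.direction = V') (hr : range S.incl = ψ '' E') : h.distribution.IsLeaf S := by
  refine ⟨inferInstance, hS, fun S' hc' hS' hsub ↦ hsub.antisymm' ?_⟩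
  obtain ⟨x, hx⟩ := hne
  rw [hr]
  exact h.range_subset_image hS' hE' hx (hsub (hr ▸ ⟨x, hx, rfl⟩))

theorem leafSets_distribution : h.distribution.leafSets = {A | ∃ E' : AffineSubspace ℝ E,
    (E' : Set E).Nonempty ∧ E'.direction = V' ∧ A = ψ '' E'} := by
  ext A
  constructor
  · rintro ⟨S, hS, rfl⟩
    exact h.exists_range_eq_of_isLeaf hS
  · rintro ⟨E', hne, hE', rfl⟩
    have : Nonempty E' := hne.to_subtype
    obtain ⟨S, hc, hS, hr⟩ := h.exists_connected_integralManifold E' hE'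
    exact ⟨S, h.isLeaf_of_range_eq hS hE' hr, hr⟩

-- The choice is made pointwise; regularity of `f` is supplied by `isLocalDiffeomorph_param`.
omit [FiniteDimensional ℝ V] [IsManifold 𝓘(ℝ, V) ∞ N] in
theorem exists_param {S : ImmersedSubmanifold V N} {E' : AffineSubspace ℝ E}
    (hr : range S.incl = ψ '' E') :
    ∃ f : E' → S.Pt, (∀ x : E', S.incl (f x) = ψ x) ∧ Function.Surjective f := by
  have h1 : ∀ x : E', ∃ p, S.incl p = ψ x := fun x ↦ hr.superset ⟨x, x.2, rfl⟩
  choose f hf using h1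
  refine ⟨f, hf, fun p ↦ ?_⟩
  obtain ⟨x, hx, hxp⟩ := hr.subset (mem_range_self p)
  exact ⟨⟨x, hx⟩, S.incl_injective ((hf _).trans hxp)⟩

theorem compactSpace_of_isLeaf (hL : IsLatticeSubspace (latticeSubgroup Γ) V')
    {S : ImmersedSubmanifold V N} (hS : h.distribution.IsLeaf S) : CompactSpace S.Pt := by
  obtain ⟨E', hne, hE', hr⟩ := h.exists_range_eq_of_isLeaf hS
  have : Nonempty E' := hne.to_subtype
  obtain ⟨f, hf, hsurj⟩ := exists_param hr
  exact h.compactSpace_of_param hS.2.1 E'.subtypeₐᵢ (range_subtypeₐᵢ_linear hE') hf hL hsurj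

end IsFlatCover

end

/-! ### Projected foliations, and the induced metric, holonomy and lattice -/

noncomputable section

universe u

section Projection

variable {V : Type*} {E : Type u} [NormedAddCommGroup V] [InnerProductSpace ℝ V]
  [MetricSpace E] [NormedAddTorsor V E]
  {N : Type u} [TopologicalSpace N] [ChartedSpace V N] [IsManifold 𝓘(ℝ, V) ∞ N]
  {Γ : Subgroup (E ≃ᵃⁱ[ℝ] E)} {V' : Submodule ℝ V}

theorem IsFlatCover.projectsOnto [FiniteDimensional ℝ V] {ψ : E → N} (h : IsFlatCover Γ V' ψ) :
    (isFlatCover_id (E := E) V').distribution.ProjectsOnto ψ h.distribution := by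
  intro x
  obtain ⟨A, hAV, hA⟩ :=
    h.exists_hasMFDerivAt x h.isLocalDiffeomorph.contMDiff.continuous.continuousAt
  rw [hA.mfderiv]
  have hiff : V'.map (A : V →L[ℝ] V).toLinearMap = V' := by
    ext v
    constructor
    · rintro ⟨w, hw, rfl⟩
      exact (hAV w).2 hw
    · intro hv
      exact ⟨A.symm v, (hAV _).1 (by simpa using hv), A.apply_symm_apply v⟩
  exact hiff

theorem quotientMetric_inner [FiniteDimensional ℝ V] (Γ : Subgroup (E ≃ᵃⁱ[ℝ] E)) [IsDiscreteTorsionFree Γ]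
    (m : FlatQuotient Γ) (a b : V) : (quotientMetric Γ).inner m a b = inner ℝ a b := rfl

/-- The identification of a leaf with a quotient of the coset parametrizing it is isometric. -/
theorem IsFlatCover.inducedInner_diffeomorph [FiniteDimensional ℝ V] [IsDiscreteTorsionFree Γ]
    {ψ : E → N} (h : IsFlatCover Γ V' ψ) {S : ImmersedSubmanifold V N}
    (hS : h.distribution.IsIntegralManifold S) {V₁ : Type*} {E₁ : Type u} [NormedAddCommGroup V₁]
    [InnerProductSpace ℝ V₁] [FiniteDimensional ℝ V₁] [MetricSpace E₁] [NormedAddTorsor V₁ E₁]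
    (j : E₁ →ᵃⁱ[ℝ] E) (hj : range j.linearIsometry = (V' : Set V)) {f : E₁ → S.Pt}
    (hf : ∀ x, S.incl (f x) = ψ (j x)) (g : SmoothMetric V N)
    (hg : ∀ (m : N) (a b : V), g.inner m a b = inner ℝ a b)
    (Φ : Diffeomorph 𝓘(ℝ, V₁) S.model (FlatQuotient (restrictSubgroup Γ j)) S.Pt ∞)
    (hΦ : ∀ x, Φ (quotientProj (restrictSubgroup Γ j) x) = f x)
    (q : FlatQuotient (restrictSubgroup Γ j)) (a b : TangentSpace 𝓘(ℝ, V₁) q) :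
    S.inducedInner g (Φ q) (mfderiv 𝓘(ℝ, V₁) S.model Φ q a) (mfderiv 𝓘(ℝ, V₁) S.model Φ q b) =
      (quotientMetric (restrictSubgroup Γ j)).inner q a b := by
  obtain ⟨x, rfl⟩ := quotientProj_surjective _ q
  have hloc := isLocalDiffeomorph_quotientProj (restrictSubgroup Γ j)
  -- Tangent vectors are lifted to `E₁`, where both metrics pull back to the inner product of `V₁`.
  have hsurj : Function.Surjective
      (mfderiv 𝓘(ℝ, V₁) 𝓘(ℝ, V₁) (quotientProj (restrictSubgroup Γ j)) x) :=
    ((hloc x).mfderivToContinuousLinearEquiv (by simp)).surjective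
  obtain ⟨a, rfl⟩ := hsurj a
  obtain ⟨b, rfl⟩ := hsurj b
  obtain rfl : Φ ∘ quotientProj (restrictSubgroup Γ j) = f := funext hΦ
  have h1 := mfderiv_comp x ((Φ.contMDiff _).mdifferentiableAt (by simp))
    ((hloc x).mdifferentiableAt (by simp))
  have h2 := h.inducedInner_param hS j hj hf g hg x a b
  rw [h1] at h2
  exact h2.trans (quotientMetric_mfderiv (restrictSubgroup Γ j) x a b).symm

/-- Membership in the induced group only says that `γ` maps `E'` into itself; surjectivity of `γ'`
makes the image all of `E'`. -/
theorem mem_restrictSubgroup_subtype_iff {E' : AffineSubspace ℝ E} [Nonempty E']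
    {γ' : E' ≃ᵃⁱ[ℝ] E'} : γ' ∈ restrictSubgroup Γ E'.subtypeₐᵢ ↔
      ∃ γ ∈ setStabilizer Γ (E' : Set E), ∀ x : E', (γ' x : E) = γ x := by
  constructor
  · rintro ⟨γ, hγ, h⟩
    refine ⟨γ, ⟨hγ, ?_⟩, h⟩
    ext y
    constructor
    · rintro ⟨x, hx, rfl⟩
      exact (h ⟨x, hx⟩) ▸ (γ' ⟨x, hx⟩).2
    · intro hy
      refine ⟨γ'.symm ⟨y, hy⟩, (γ'.symm ⟨y, hy⟩).2, ?_⟩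
      refine (h (γ'.symm ⟨y, hy⟩)).symm.trans ?_
      rw [γ'.apply_symm_apply]
      rfl
  · rintro ⟨γ, hγ, h⟩
    exact ⟨γ, hγ.1, h⟩

theorem mem_holonomyGroup_restrict_iff [FiniteDimensional ℝ V] {E' : AffineSubspace ℝ E} [Nonempty E']
    {B : E'.direction ≃ₗᵢ[ℝ] E'.direction} :
    B ∈ holonomyGroup (restrictSubgroup Γ E'.subtypeₐᵢ) ↔
      ∃ γ ∈ setStabilizer Γ (E' : Set E), ∀ v : E'.direction, (B v : V) = γ.linearIsometryEquiv v := by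
  constructor
  · rintro ⟨γ', hγ', rfl⟩
    obtain ⟨γ, hγ, h⟩ := mem_restrictSubgroup_subtype_iff.1 hγ'
    exact ⟨γ, hγ, linearIsometry_restrict (j := E'.subtypeₐᵢ) h⟩
  · rintro ⟨γ, hγ, h⟩
    obtain ⟨x⟩ : Nonempty E' := inferInstance
    have hx : γ x ∈ E' := hγ.2.subset ⟨x, x.2, rfl⟩
    have hV : ∀ v ∈ E'.direction, γ.linearIsometryEquiv v ∈ E'.direction := fun v hv ↦
      h ⟨v, hv⟩ ▸ (B ⟨v, hv⟩).2
    obtain ⟨γ', hγ'⟩ := exists_restrict (j := E'.subtypeₐᵢ)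
      (IsFlatCover.range_subtypeₐᵢ_linear rfl) hV (x := x) (y := ⟨γ x, hx⟩) rfl
    refine ⟨γ', ⟨γ, hγ.1, hγ'⟩, ?_⟩
    ext v
    exact (linearIsometry_restrict hγ' v).trans (h v).symm

theorem mem_latticeSubgroup_restrict {E' : AffineSubspace ℝ E} [Nonempty E'] {v : E'.direction}
    (hv : (v : V) ∈ latticeSubgroup Γ) : v ∈ latticeSubgroup (restrictSubgroup Γ E'.subtypeₐᵢ) :=
  ⟨_, vadd_restrict_mem E'.subtypeₐᵢ hv, fun _ ↦ rfl⟩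

end Projection

end

/-! ### The foliations of `E`, `E / P` and `E / L` -/

theorem theorem6p1 {V E : Type*} [NormedAddCommGroup V] [InnerProductSpace ℝ V]
    [FiniteDimensional ℝ V] [MetricSpace E] [NormedAddTorsor V E]
    (P : Subgroup (E ≃ᵃⁱ[ℝ] E)) [IsBieberbach P]
    (V' : Submodule ℝ V) (hbot : V' ≠ ⊥) (htop : V' ≠ ⊤)
    (hH : ∀ A ∈ holonomyGroup P, ∀ v ∈ V', A v ∈ V')
    (hL : IsLatticeSubspace (latticeSubgroup P) V') :
    ∃ (DE : TangentDistribution V E) (DM : TangentDistribution V (FlatQuotient P))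
      (DT : TangentDistribution V (FlatQuotient (translationSubgroup P))),
      -- the cosets of `V'` are the leaves of a foliation of `E`
      (∀ x : E, DE.fiber x = (V' : Submodule ℝ V)) ∧
      DE.IsIntegrable ∧
      DE.leafSets = {A | ∃ E' : AffineSubspace ℝ E,
        (E' : Set E).Nonempty ∧ E'.direction = V' ∧ A = (E' : Set E)} ∧
      -- which is projectable onto foliations of `M = E / P` and `T = E / L`
      DE.ProjectsOnto (quotientProj P) DM ∧ DM.IsIntegrable ∧
      DE.ProjectsOnto (quotientProj (translationSubgroup P)) DT ∧ DT.IsIntegrable ∧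
      -- tangent to parallel distributions, with compact totally geodesic leaves
      DM.IsParallel (quotientMetric P) ∧ DT.IsParallel (quotientMetric (translationSubgroup P)) ∧
      (∀ S, DM.IsLeaf S → CompactSpace S.Pt ∧ S.IsTotallyGeodesic (quotientMetric P)) ∧
      (∀ S, DT.IsLeaf S →
        CompactSpace S.Pt ∧ S.IsTotallyGeodesic (quotientMetric (translationSubgroup P))) ∧
      -- the leaves of which are the images of the cosets
      DM.leafSets = (fun A ↦ quotientProj P '' A) '' DE.leafSets ∧
      DT.leafSets = (fun A ↦ quotientProj (translationSubgroup P) '' A) '' DE.leafSets ∧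
      ∀ (E' : AffineSubspace ℝ E) [Nonempty E'], E'.direction = V' →
        -- and the restrictions of the projections to them are coverings
        (∀ S, DT.IsLeaf S → range S.incl = quotientProj (translationSubgroup P) '' E' →
          ∃ f : E' → S.Pt, (∀ x, S.incl (f x) = quotientProj (translationSubgroup P) (x : E)) ∧
            IsSmoothCovering (F := EuclideanSpace ℝ (Fin S.dim)) (F' := E'.direction) f) ∧
        ∀ S, DM.IsLeaf S → range S.incl = quotientProj P '' E' →
          (∃ f : E' → S.Pt, (∀ x, S.incl (f x) = quotientProj P (x : E)) ∧
            IsSmoothCovering (F := EuclideanSpace ℝ (Fin S.dim)) (F' := E'.direction) f) ∧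
          -- the leaf is flat, and isometric to the quotient of `E'` by a Bieberbach group `P'`
          S.IsFlat (quotientMetric P) ∧
          ∃ (P' : Subgroup (E' ≃ᵃⁱ[ℝ] E')) (_ : IsBieberbach P')
            (Φ : Diffeomorph 𝓘(ℝ, E'.direction) S.model (FlatQuotient P') S.Pt ∞),
            (∀ x : E', S.incl (Φ (quotientProj P' x)) = quotientProj P (x : E)) ∧
            (∀ (q : FlatQuotient P') (a b : TangentSpace 𝓘(ℝ, E'.direction) q),
              S.inducedInner (quotientMetric P) (Φ q)
                (mfderiv 𝓘(ℝ, E'.direction) S.model Φ q a)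
                (mfderiv 𝓘(ℝ, E'.direction) S.model Φ q b) = (quotientMetric P').inner q a b) ∧
            -- `P'` consists of the restrictions of the stabilizer of `E'`
            (∀ γ' : E' ≃ᵃⁱ[ℝ] E', γ' ∈ P' ↔
              ∃ γ ∈ setStabilizer P (E' : Set E), ∀ x : E', (γ' x : E) = γ x) ∧
            -- its holonomy group consists of the restrictions of their linear parts
            (∀ B : E'.direction ≃ₗᵢ[ℝ] E'.direction, B ∈ holonomyGroup P' ↔
              ∃ γ ∈ setStabilizer P (E' : Set E), ∀ v : E'.direction,
                (B v : V) = γ.linearIsometryEquiv v) ∧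
            -- its lattice subgroup contains `L ∩ V'`
            (∀ v : E'.direction, (v : V) ∈ latticeSubgroup P → v ∈ latticeSubgroup P') := by

  have hP : ∀ γ ∈ P, ∀ v, γ.linearIsometryEquiv v ∈ V' ↔ v ∈ V' := fun γ hγ ↦
    linear_mem_iff_of_le _ V' (hH _ ⟨γ, hγ, rfl⟩)
  have hL' : IsLatticeSubspace (latticeSubgroup (translationSubgroup P)) V' := by
    rwa [latticeSubgroup_translationSubgroup]
  have hE := isFlatCover_id (E := E) V'
  have hM := isFlatCover_quotientProj P V' hP
  have hT := isFlatCover_quotientProj (translationSubgroup P) V' fun γ hγ ↦ hP γ hγ.1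
  have himage : ∀ {N : Type _} (ψ : E → N), {A | ∃ E' : AffineSubspace ℝ E,
      (E' : Set E).Nonempty ∧ E'.direction = V' ∧ A = ψ '' E'} =
      (fun A ↦ ψ '' A) '' {A | ∃ E' : AffineSubspace ℝ E,
        (E' : Set E).Nonempty ∧ E'.direction = V' ∧ A = (E' : Set E)} := by
    intro N ψ
    ext A
    constructor
    · rintro ⟨E', hne, hE', rfl⟩
      exact ⟨E', ⟨E', hne, hE', rfl⟩, rfl⟩
    · rintro ⟨_, ⟨E', hne, hE', rfl⟩, rfl⟩
      exact ⟨E', hne, hE', rfl⟩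
  have hleaf : hE.distribution.leafSets = {A | ∃ E' : AffineSubspace ℝ E,
      (E' : Set E).Nonempty ∧ E'.direction = V' ∧ A = (E' : Set E)} := by
    rw [hE.leafSets_distribution]
    simp only [image_id]
  refine ⟨hE.distribution, hM.distribution, hT.distribution, fun _ ↦ rfl, hE.isIntegrable, hleaf,
    hM.projectsOnto, hM.isIntegrable, hT.projectsOnto, hT.isIntegrable,
    hM.isParallel _ (quotientMetric_inner _), hT.isParallel _ (quotientMetric_inner _),
    fun S hS ↦ ⟨hM.compactSpace_of_isLeaf hL hS,
      hM.isTotallyGeodesic _ (quotientMetric_inner _) hS.2.1⟩,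
    fun S hS ↦ ⟨hT.compactSpace_of_isLeaf hL' hS,
      hT.isTotallyGeodesic _ (quotientMetric_inner _) hS.2.1⟩,
    by rw [hM.leafSets_distribution, hleaf, himage],
    by rw [hT.leafSets_distribution, hleaf, himage], ?_⟩
  intro E' _ hE'
  have hj := IsFlatCover.range_subtypeₐᵢ_linear hE'
  constructor
  · intro S hS hr
    obtain ⟨f, hf, hsurj⟩ := IsFlatCover.exists_param hr
    exact ⟨f, hf, hT.isSmoothCovering_param hS.2.1 E'.subtypeₐᵢ hj hf hsurj⟩
  intro S hS hr
  obtain ⟨f, hf, hsurj⟩ := IsFlatCover.exists_param hr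
  have hS' := hS.2.1
  refine ⟨⟨f, hf, hM.isSmoothCovering_param hS' E'.subtypeₐᵢ hj hf hsurj⟩,
    hM.isFlat_of_param hS' E'.subtypeₐᵢ hj hf _ (quotientMetric_inner _) hsurj, ?_⟩
  obtain ⟨Φ, hΦ⟩ := hM.exists_diffeomorph hS' E'.subtypeₐᵢ hj hf hsurj
  refine ⟨restrictSubgroup P E'.subtypeₐᵢ, isBieberbach_restrictSubgroup hL E'.subtypeₐᵢ hj, Φ,
    fun x ↦ ?_, fun q a b ↦ ?_, fun γ' ↦ mem_restrictSubgroup_subtype_iff,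
    fun B ↦ mem_holonomyGroup_restrict_iff, fun v hv ↦ mem_latticeSubgroup_restrict hv⟩
  · rw [hΦ, hf]
  · exact hM.inducedInner_diffeomorph hS' E'.subtypeₐᵢ hj hf _ (quotientMetric_inner _) Φ hΦ q a b
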